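/- **Theorem 2 (underwater ridge).** Let $a>b>0$, $\xi>0$, $\psi\in\mathbb R$ with $(\xi^2+a)\sin^2\psi\neq\xi^2+b$. Consider the Hamiltonian system $\dot x=H_p$, $\dot p=-H_x$ on $\{(x,p)\in\mathbb R^2\times\mathbb R^2: p\ne0\}$ with $$H=\sqrt{p_{x_1}^2+p_{x_2}^2}\,\sqrt{\frac{x_1^2+b}{x_1^2+a}},\qquad x|_{t=0}=(-\xi,0),\quad p|_{t=0}=(\cos\psi,\sin\psi).$$ Put $$h^2=\mathfrak h=\frac{\xi^2+b}{(\xi^2+b)-(\xi^2+a)\sin^2\psi},\qquad \gamma=\sin\psi,\qquad \delta=\tfrac13\big((b-a)\mathfrak h+3a-2b\big),$$ $$\alpha=\tfrac43\big((b-a)^2\mathfrak h^2-(b-a)b\,\mathfrak h+b^2\big),\qquad \beta=\tfrac4{27}\big((b-a)\mathfrak h+b\big)\big((b-a)\mathfrak h-2b\big)\big(2(b-a)\mathfrak h-b\big),$$ where $h$ is the principal square root of $\mathfrak h$ ($h=i\sqrt{|\mathfrak h|}$ if $\mathfrak h<0$). Let $\sqrt{1-\mathfrak h^{-1}}$ and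 $\sqrt{\mathfrak h-1}$ denote the principal square roots if $\sin\psi\ge0$ and their negatives if $\sin\psi<0$; if $\sin\psi=0$ (so $\mathfrak h=1$), the quotient $\gamma/\sqrt{\mathfrak h-1}$ stands for $\sqrt{(\xi^2+b)/(\xi^2+a)}$. There is a period lattice with invariants $g_2=\alpha$, $g_3=\beta$. Let $\wp=\wp(\,\cdot\,;\alpha,\beta)$ and $\zeta=\zeta(\,\cdot\,;\alpha,\beta)$ be the Weierstrass functions of such a lattice $\Lambda$. There is $\mathfrak p_0\in\mathbb C\setminus\Lambda$ with $$\wp(\mathfrak p_0)=\xi^2-\delta+a\qquad\text{and}\qquad \operatorname{Re}\!\Big(\frac{\wp'(\mathfrak p_0)}{h}\Big)\cos\psi\le0,$$ and for every such $\mathfrak p_0$ the following holds. (i) There is exactly one continuous function $\mathfrak p:\mathbb R\to\mathbb C\setminus\Lambda$ with $\mathfrak p(0)=\mathfrak p_0$ and $$\frac th=\delta\,(\mathfrak p(t)-\mathfrak p_0)-\zeta(\mathfrak p(t))+\zeta(\mathfrak p_0)\qquad(t\in\mathbb R),$$ and there is exactly one differentiable function $r:\mathbb R\to\mathbb R$ with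 $r(0)=\xi$ and $r(t)^2=\wp(\mathfrak p(t))+\delta-a$ for all $t$; write $\sqrt{\wp(\mathfrak p)+\delta-a}$ for $r$. (ii) The Cauchy problem has a solution on all of $\mathbb R$, every solution on an open interval containing $0$ is a restriction of it, and it is given by $$x_1=-\sqrt{\wp(\mathfrak p)+\delta-a},\qquad x_2=\sqrt{1-\mathfrak h^{-1}}\;t+\sqrt{\mathfrak h-1}\,(b-a)(\mathfrak p-\mathfrak p_0),$$ $$p_{x_1}=-\frac12\,\frac{\gamma}{\sqrt{\mathfrak h-1}}\,\frac{\wp'(\mathfrak p)}{\wp(\mathfrak p)+\delta-a+b}\,\frac1{\sqrt{\wp(\mathfrak p)+\delta-a}},\qquad p_{x_2}=\gamma=\sin\psi,$$ the formula for $p_{x_1}$ being asserted at the times $t$ with $x_1(t)\neq0$. -/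

import Mathlib

noncomputable section

namespace Ridge

/-! ### The Weierstrass functions with given invariants -/

/-- `L` is a period lattice with invariants `g₂ = α`, `g₃ = β`; the functions `℘(·; α, β)` and
`ζ(·; α, β)` are the Weierstrass functions of this lattice. -/
def HasInvariants (L : PeriodPair) (α β : ℝ) : Prop :=
  L.g₂ = (α : ℂ) ∧ L.g₃ = (β : ℂ)

/-- The Weierstrass zeta function `1/z + ∑_{l ≠ 0} (1/(z-l) + 1/l + z/l²)` of the lattice of `L`.
(The summand with `l = 0` is `1/z`, since division by zero gives zero.) -/
def weierstrassZeta (L : PeriodPair) (z : ℂ) : ℂ :=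
  ∑' l : L.lattice, (1 / (z - l) + 1 / (l : ℂ) + z / (l : ℂ) ^ 2)

/-! ### The Hamiltonian system -/

/-- The depth `D(x₁, x₂)` of the water layer over the ridge. -/
def depth (a b x₁ _x₂ : ℝ) : ℝ := (x₁ ^ 2 + b) / (x₁ ^ 2 + a)

/-- The Hamiltonian `H = |p| √D(x)`. -/
def hamiltonian (a b x₁ x₂ p₁ p₂ : ℝ) : ℝ :=
  √(p₁ ^ 2 + p₂ ^ 2) * √(depth a b x₁ x₂)

/-- `(x₁, x₂, p₁, p₂)` solves `ẋ = ∂H/∂p`, `ṗ = -∂H/∂x` on the time set `I`. The momentum does not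
vanish, as `H` is differentiable only where `p ≠ 0`. -/
structure IsSolutionOn (a b : ℝ) (I : Set ℝ) (x₁ x₂ p₁ p₂ : ℝ → ℝ) : Prop where
  momentum_ne_zero : ∀ t ∈ I, ¬ (p₁ t = 0 ∧ p₂ t = 0)
  x₁_dot : ∀ t ∈ I,
    HasDerivAt x₁ (deriv (fun u => hamiltonian a b (x₁ t) (x₂ t) u (p₂ t)) (p₁ t)) t
  x₂_dot : ∀ t ∈ I,
    HasDerivAt x₂ (deriv (fun u => hamiltonian a b (x₁ t) (x₂ t) (p₁ t) u) (p₂ t)) t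
  p₁_dot : ∀ t ∈ I,
    HasDerivAt p₁ (-deriv (fun u => hamiltonian a b u (x₂ t) (p₁ t) (p₂ t)) (x₁ t)) t
  p₂_dot : ∀ t ∈ I,
    HasDerivAt p₂ (-deriv (fun u => hamiltonian a b (x₁ t) u (p₁ t) (p₂ t)) (x₂ t)) t

/-- The initial conditions `x = (-ξ, 0)`, `p = (cos ψ, sin ψ)` at `t = 0`. -/
def HasInitialData (ξ ψ : ℝ) (x₁ x₂ p₁ p₂ : ℝ → ℝ) : Prop :=
  x₁ 0 = -ξ ∧ x₂ 0 = 0 ∧ p₁ 0 = Real.cos ψ ∧ p₂ 0 = Real.sin ψ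

/-! ### The constants -/

/-- The constant `𝔥`. -/
def frakh (a b ξ ψ : ℝ) : ℝ :=
  (ξ ^ 2 + b) / ((ξ ^ 2 + b) - (ξ ^ 2 + a) * Real.sin ψ ^ 2)

/-- The principal complex square root of a real number (`i √|s|` for `s < 0`). -/
def csqrt (s : ℝ) : ℂ := Complex.sqrt (s : ℂ)

/-- The constant `h` with `h² = 𝔥` (principal root). -/
def h (a b ξ ψ : ℝ) : ℂ := csqrt (frakh a b ξ ψ)

/-- The constant `δ`. -/
def delta (a b ξ ψ : ℝ) : ℝ := 1 / 3 * ((b - a) * frakh a b ξ ψ + 3 * a - 2 * b)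

/-- The constant `α`. -/
def alpha (a b ξ ψ : ℝ) : ℝ :=
  4 / 3 * ((b - a) ^ 2 * frakh a b ξ ψ ^ 2 - (b - a) * b * frakh a b ξ ψ + b ^ 2)

/-- The constant `β`. -/
def beta (a b ξ ψ : ℝ) : ℝ :=
  4 / 27 * ((b - a) * frakh a b ξ ψ + b) * ((b - a) * frakh a b ξ ψ - 2 * b) *
    (2 * (b - a) * frakh a b ξ ψ - b)

/-- The common sign of the square roots `√(1 - 1/𝔥)` and `√(𝔥 - 1)`: the sign of `sin ψ`. -/
def rootSign (ψ : ℝ) : ℝ := if Real.sin ψ < 0 then -1 else 1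

/-- The coefficient `γ / √(𝔥 - 1)`, `γ = sin ψ`, of the first momentum; for `sin ψ = 0`, where
`𝔥 = 1`, it stands for its limit. -/
def momentumCoeff (a b ξ ψ : ℝ) : ℂ :=
  if Real.sin ψ = 0 then ((√((ξ ^ 2 + b) / (ξ ^ 2 + a)) : ℝ) : ℂ)
  else (Real.sin ψ : ℂ) / ((rootSign ψ : ℂ) * csqrt (frakh a b ξ ψ - 1))

/-! ### The transcendental equations -/

/-- `p₀` is a root of `℘(p₀) = ξ² - δ + a`, on the branch where `℘'(p₀)/h` (a real number) and
`cos ψ` have opposite signs. -/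
def IsInitialPhase (a b ξ ψ : ℝ) (L : PeriodPair) (p₀ : ℂ) : Prop :=
  p₀ ∉ L.lattice ∧
  L.weierstrassP p₀ = ((ξ ^ 2 - delta a b ξ ψ + a : ℝ) : ℂ) ∧
  (L.derivWeierstrassP p₀ / h a b ξ ψ).re * Real.cos ψ ≤ 0

/-- `p` is the continuous branch, with `p(0) = p₀`, of roots of
`t / h = δ (p - p₀) - ζ(p) + ζ(p₀)`. -/
structure IsPhase (a b ξ ψ : ℝ) (L : PeriodPair) (p₀ : ℂ) (p : ℝ → ℂ) : Prop where
  continuous : Continuous p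
  initial : p 0 = p₀
  notMem : ∀ t, p t ∉ L.lattice
  equation : ∀ t : ℝ, (t : ℂ) / h a b ξ ψ =
    (delta a b ξ ψ : ℂ) * (p t - p₀) - weierstrassZeta L (p t) + weierstrassZeta L p₀

/-- `r` is the differentiable branch of `t ↦ √(℘(p(t)) + δ - a)` that is `ξ` at `t = 0`. It is
the non-negative root up to the first time when the radicand vanishes, and changes sign there. -/
structure IsRootBranch (a b ξ ψ : ℝ) (L : PeriodPair) (p : ℝ → ℂ) (r : ℝ → ℝ) : Prop where
  differentiable : Differentiable ℝ r
  initial : r 0 = ξ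
  sq : ∀ t, (r t : ℂ) ^ 2 = L.weierstrassP (p t) + (delta a b ξ ψ : ℂ) - (a : ℂ)

end Ridge

end

/-!
The momentum `p₂` and the Hamiltonian `H` are conserved, so the first coordinate obeys
`ẋ² = D(x) - κ D(x)²` with `κ = p₂² / H² = 1 - 𝔥⁻¹`. Its derivative `ẍ = ½ (D - κ D²)'(x)` has a
globally Lipschitz right-hand side, hence a unique solution for all times, which passes through the
ridge `x = 0` with nonzero velocity. Along the phase `𝔭 = 𝔭₀ + h⁻¹ ∫ ds / (x² + a)`, the pair
`(x² - δ + a, 2 h x ẋ (x² + a))` solves the system `(℘, ℘')' = (℘', 6 ℘² - g₂ / 2)`, so it is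
`(℘(𝔭), ℘'(𝔭))`; in particular `𝔭` never meets a pole. As `ζ' = -℘`, the transcendental equation
says `(δ + ℘(𝔭)) 𝔭̇ = h⁻¹`, which determines `𝔭` because `δ + ℘(𝔭) = x² + a ≠ 0`.

A lattice with given invariants `g₂`, `g₃` exists if `g₂³ ≠ 27 g₃²`: prescribing the ratio of `g₂³`
and `g₃²` amounts to finding a zero of `A E₄³ - B E₆²` with `A ≠ B`, and this modular form has one,
since it does not vanish at the cusp and its inverse would otherwise have negative weight.
-/

open Filter Topology

namespace Ridge

/-! ### Weierstrass functions -/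

section Weierstrass

open scoped PeriodPair

variable (L : PeriodPair)

lemma isOpen_compl_lattice : IsOpen (L.lattice : Set ℂ)ᶜ := L.isClosed_lattice.isOpen_compl

lemma eventually_notMem_lattice {z : ℂ} (hz : z ∉ L.lattice) : ∀ᶠ w in 𝓝 z, w ∉ L.lattice :=
  (isOpen_compl_lattice L).mem_nhds hz

lemma eventually_nhdsNE_notMem_lattice (z : ℂ) : ∀ᶠ w in 𝓝[≠] z, w ∉ L.lattice := by
  filter_upwards [nhdsWithin_le_nhds (L.compl_lattice_sdiff_singleton_mem_nhds z),
    self_mem_nhdsWithin] with w hw hne hmem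
  exact hw ⟨hmem, hne⟩

lemma isPreconnected_compl_lattice : IsPreconnected (L.lattice : Set ℂ)ᶜ :=
  have : (L.lattice : Set ℂ).Countable :=
    Set.countable_coe_iff.mp (L.latticeEquivProd.toEquiv.countable_iff.mpr inferInstance)
  (this.isConnected_compl_of_one_lt_rank (by simp)).isPreconnected

lemma hasDerivAt_weierstrassP {z : ℂ} (hz : z ∉ L.lattice) : HasDerivAt ℘[L] (℘'[L] z) z := by
  rw [← L.deriv_weierstrassP]
  exact (L.analyticOnNhd_weierstrassP z hz).differentiableAt.hasDerivAt

lemma tendsto_weierstrassP_cobounded {l : ℂ} (hl : l ∈ L.lattice) :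
    Tendsto ℘[L] (𝓝[≠] l) (Bornology.cobounded ℂ) :=
  tendsto_cobounded_of_meromorphicOrderAt_neg <| by
    rw [L.order_weierstrassP l hl]
    decide

/-- The function `1 / (℘ - w)`, extended by zero to the poles of `℘`; it is entire if `℘` omits the
value `w`. -/
noncomputable def invWeierstrassPSub (w : ℂ) : ℂ → ℂ :=
  (L.lattice : Set ℂ)ᶜ.indicator fun z ↦ (℘[L] z - w)⁻¹

variable {L} in
lemma invWeierstrassPSub_of_notMem (w : ℂ) {z : ℂ} (hz : z ∉ L.lattice) :
    invWeierstrassPSub L w z = (℘[L] z - w)⁻¹ :=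
  Set.indicator_of_mem hz _

variable {L} in
lemma invWeierstrassPSub_of_mem (w : ℂ) {z : ℂ} (hz : z ∈ L.lattice) :
    invWeierstrassPSub L w z = 0 :=
  Set.indicator_of_notMem (not_not_intro hz) _

lemma invWeierstrassPSub_add (w z : ℂ) {l : ℂ} (hl : l ∈ L.lattice) :
    invWeierstrassPSub L w (z + l) = invWeierstrassPSub L w z := by
  by_cases hz : z ∈ L.lattice
  · rw [invWeierstrassPSub_of_mem w hz, invWeierstrassPSub_of_mem w (add_mem hz hl)]
  · rw [invWeierstrassPSub_of_notMem w hz, invWeierstrassPSub_of_notMem w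
      (mt (L.lattice.add_mem_iff_left hl).mp hz), L.weierstrassP_add_coe z ⟨l, hl⟩]

lemma continuousAt_invWeierstrassPSub_of_mem (w : ℂ) {l : ℂ} (hl : l ∈ L.lattice) :
    ContinuousAt (invWeierstrassPSub L w) l := by
  rw [continuousAt_iff_punctured_nhds, invWeierstrassPSub_of_mem w hl]
  refine ((tendsto_inv₀_cobounded (α := ℂ)).comp ((tendsto_sub_const_cobounded w).comp
    (tendsto_weierstrassP_cobounded L hl))).congr' ?_
  filter_upwards [eventually_nhdsNE_notMem_lattice L l] with z hz
  exact (invWeierstrassPSub_of_notMem w hz).symm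

lemma differentiable_invWeierstrassPSub {w : ℂ} (hw : ∀ z, z ∉ L.lattice → ℘[L] z ≠ w) :
    Differentiable ℂ (invWeierstrassPSub L w) := by
  have hoff : ∀ z, z ∉ L.lattice → DifferentiableAt ℂ (invWeierstrassPSub L w) z := by
    intro z hz
    refine (((hasDerivAt_weierstrassP L hz).differentiableAt.sub_const w).inv
      (sub_ne_zero.mpr (hw z hz))).congr_of_eventuallyEq ?_
    filter_upwards [eventually_notMem_lattice L hz] with y hy
    exact invWeierstrassPSub_of_notMem w hy
  intro z
  by_cases hz : z ∈ L.lattice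
  · exact (Complex.analyticAt_of_differentiable_on_punctured_nhds_of_continuousAt
      ((eventually_nhdsNE_notMem_lattice L z).mono hoff)
      (continuousAt_invWeierstrassPSub_of_mem L w hz)).differentiableAt
  · exact hoff z hz

lemma exists_weierstrassP_eq (w : ℂ) : ∃ z, z ∉ L.lattice ∧ ℘[L] z = w := by
  by_contra! hw
  have hd := differentiable_invWeierstrassPSub L hw
  have hb := (IsZLattice.isCompact_range_of_periodic L.lattice _ hd.continuous
    fun z _ hl ↦ invWeierstrassPSub_add L w z hl).isBounded
  have hconst := hd.apply_eq_apply_of_bounded hb (L.ω₁ / 2) 0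
  rw [invWeierstrassPSub_of_notMem w L.ω₁_div_two_notMem_lattice,
    invWeierstrassPSub_of_mem w L.lattice.zero_mem, inv_eq_zero, sub_eq_zero] at hconst
  exact hw _ L.ω₁_div_two_notMem_lattice hconst

lemma exists_derivWeierstrassP_ne_zero : ∃ z, z ∉ L.lattice ∧ ℘'[L] z ≠ 0 := by
  by_contra! hzero
  obtain ⟨z₀, hz₀, h0⟩ := exists_weierstrassP_eq L 0
  obtain ⟨z₁, hz₁, h1⟩ := exists_weierstrassP_eq L 1
  have hconst : ℘[L] z₀ = ℘[L] z₁ :=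
    (isOpen_compl_lattice L).is_const_of_deriv_eq_zero (isPreconnected_compl_lattice L)
      L.differentiableOn_weierstrassP (by rw [L.deriv_weierstrassP]; exact hzero) hz₀ hz₁
  rw [h0, h1] at hconst
  exact zero_ne_one hconst

lemma derivWeierstrassP_mul_deriv {z : ℂ} (hz : z ∉ L.lattice) :
    ℘'[L] z * (deriv ℘'[L] z - (6 * ℘[L] z ^ 2 - L.g₂ / 2)) = 0 := by
  have hP := hasDerivAt_weierstrassP L hz
  have hleft := (L.analyticOnNhd_derivWeierstrassP z hz).differentiableAt.hasDerivAt.pow 2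
  have hright := (((hP.pow 3).const_mul 4).sub (hP.const_mul L.g₂)).sub_const L.g₃
  have h := hleft.unique <| hright.congr_of_eventuallyEq <| by
    filter_upwards [eventually_notMem_lattice L hz] with w hw
    exact L.derivWeierstrassP_sq w hw
  simp only [Nat.cast_ofNat] at h
  linear_combination h / 2

lemma deriv_derivWeierstrassP {z : ℂ} (hz : z ∉ L.lattice) :
    deriv ℘'[L] z = 6 * ℘[L] z ^ 2 - L.g₂ / 2 := by
  have hP : AnalyticOnNhd ℂ ℘[L] (L.lattice : Set ℂ)ᶜ := L.analyticOnNhd_weierstrassP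
  have hP' : AnalyticOnNhd ℂ ℘'[L] (L.lattice : Set ℂ)ᶜ := L.analyticOnNhd_derivWeierstrassP
  have hdiff : AnalyticOnNhd ℂ (fun w ↦ deriv ℘'[L] w - (6 * ℘[L] w ^ 2 - L.g₂ / 2))
      (L.lattice : Set ℂ)ᶜ :=
    hP'.deriv.sub ((analyticOnNhd_const.mul (hP.pow 2)).sub analyticOnNhd_const)
  obtain ⟨w, hw, hw'⟩ := exists_derivWeierstrassP_ne_zero L
  rcases hP'.eq_zero_or_eq_zero_of_mul_eq_zero hdiff
    (fun _ ↦ derivWeierstrassP_mul_deriv L) (isPreconnected_compl_lattice L) with h | h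
  · exact absurd (h w hw) hw'
  · exact sub_eq_zero.mp (h z hz)

lemma hasDerivAt_derivWeierstrassP {z : ℂ} (hz : z ∉ L.lattice) :
    HasDerivAt ℘'[L] (6 * ℘[L] z ^ 2 - L.g₂ / 2) z := by
  rw [← deriv_derivWeierstrassP L hz]
  exact (L.analyticOnNhd_derivWeierstrassP z hz).differentiableAt.hasDerivAt

lemma norm_weierstrassZeta_summand_le {r : ℝ} {z l : ℂ} (hz : ‖z‖ < r) (hl : 2 * r ≤ ‖l‖) :
    ‖1 / (z - l) + 1 / l + z / l ^ 2‖ ≤ 2 * r ^ 2 * ‖l‖ ^ (-3 : ℝ) := by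
  have hl0 : 0 < ‖l‖ := by linarith [norm_nonneg z]
  have hsub : ‖l‖ / 2 ≤ ‖z - l‖ := by
    rw [norm_sub_rev]
    exact le_trans (by linarith) (norm_sub_norm_le l z)
  have hl_ne : l ≠ 0 := norm_pos_iff.mp hl0
  have hzl_ne : z - l ≠ 0 := norm_pos_iff.mp (by linarith)
  calc ‖1 / (z - l) + 1 / l + z / l ^ 2‖ = ‖z ^ 2 / ((z - l) * l ^ 2)‖ := by
        congr 1
        field_simp
        ring
    _ = ‖z‖ ^ 2 / (‖z - l‖ * ‖l‖ ^ 2) := by rw [norm_div, norm_mul, norm_pow, norm_pow]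
    _ ≤ r ^ 2 / (‖l‖ / 2 * ‖l‖ ^ 2) := by gcongr
    _ = 2 * r ^ 2 * (‖l‖ ^ 3)⁻¹ := by field_simp
    _ = 2 * r ^ 2 * ‖l‖ ^ (-3 : ℝ) := by norm_cast

lemma hasSumLocallyUniformly_weierstrassZeta :
    HasSumLocallyUniformly
      (fun (l : L.lattice) (z : ℂ) ↦ 1 / (z - l) + 1 / (l : ℂ) + z / (l : ℂ) ^ 2)
      (weierstrassZeta L) := by
  refine L.hasSumLocallyUniformly_aux _ (fun r l ↦ 2 * r ^ 2 * ‖l‖ ^ (-3 : ℝ))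
    (fun _ _ ↦ (ZLattice.summable_norm_rpow _ _ (by simp; norm_num)).mul_left _) fun r _ ↦ ?_
  filter_upwards [eventually_ge_atTop (2 * r)]
  rintro _ h z hz l rfl
  exact norm_weierstrassZeta_summand_le hz h

lemma hasDerivAt_weierstrassZeta_summand {z l : ℂ} (h : z - l ≠ 0) :
    HasDerivAt (fun w : ℂ ↦ 1 / (w - l) + 1 / l + w / l ^ 2)
      (-(1 / (z - l) ^ 2 - 1 / l ^ 2)) z := by
  have hinv : HasDerivAt (fun w : ℂ ↦ 1 / (w - l)) (-1 / (z - l) ^ 2) z := by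
    simpa only [one_div] using ((hasDerivAt_id' z).sub_const l).fun_inv h
  refine ((hinv.add_const (1 / l)).fun_add
    ((hasDerivAt_id' z).div_const (l ^ 2))).congr_deriv ?_
  ring

lemma hasDerivAt_weierstrassZeta {z : ℂ} (hz : z ∉ L.lattice) :
    HasDerivAt (weierstrassZeta L) (-℘[L] z) z := by
  have hsub : ∀ w ∉ L.lattice, ∀ l : L.lattice, w - (l : ℂ) ≠ 0 :=
    fun w hw l h ↦ hw (sub_eq_zero.mp h ▸ l.2)
  refine hasDerivAt_of_tendstoLocallyUniformlyOn (l := atTop) (g' := fun w ↦ -℘[L] w)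
    (isOpen_compl_lattice L) ?_
    (.of_forall fun s w hw ↦
      HasDerivAt.fun_sum fun l _ ↦ hasDerivAt_weierstrassZeta_summand (hsub w hw l))
    (fun w _ ↦ (hasSumLocallyUniformly_weierstrassZeta L).hasSum) hz
  have hP := (hasSumLocallyUniformly_iff_tendstoLocallyUniformly.mp
    L.hasSumLocallyUniformly_weierstrassP).tendstoLocallyUniformlyOn (s := (L.lattice : Set ℂ)ᶜ)
  exact hP.neg.congr fun s w _ ↦ by simp only [Pi.neg_apply, Finset.sum_neg_distrib]

end Weierstrass

/-! ### Lattices with prescribed invariants -/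

section Lattices

open ModularForm ModularFormClass UpperHalfPlane MatrixGroups EisensteinSeries

lemma tendsto_atImInfty_qExpansion_coeff_zero {k : ℤ} (f : ModularForm 𝒮ℒ k) :
    Tendsto f atImInfty (𝓝 ((qExpansion 1 f).coeff 0)) := by
  have hper := SlashInvariantFormClass.periodic_comp_ofComplex f one_mem_strictPeriods_SL
  have han : AnalyticAt ℂ (cuspFunction 1 f) 0 :=
    UpperHalfPlane.analyticAt_cuspFunction_zero one_pos hper (holo f) (bdd_at_infty f)
  rw [UpperHalfPlane.qExpansion_coeff_zero one_pos han hper,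
    ← cuspFunction_apply_zero one_pos han hper]
  refine (han.continuousAt.tendsto.comp (qParam_tendsto_atImInfty one_pos)).congr fun τ ↦ ?_
  exact UpperHalfPlane.eq_cuspFunction τ one_ne_zero hper

-- If `f` had no zero, `1 / f` would be a nonzero modular form of negative weight.
lemma exists_zero_of_tendsto_atImInfty {k : ℤ} (hk : 0 < k) (f : ModularForm 𝒮ℒ k) {c : ℂ}
    (hc : c ≠ 0) (hf : Tendsto f atImInfty (𝓝 c)) : ∃ z, f z = 0 := by
  by_contra! hne
  have hslash (γ : SL(2, ℤ)) :
      ((1 : ModularForm 𝒮ℒ 0) / f : ℍ → ℂ) ∣[0 - k] γ = (1 : ModularForm 𝒮ℒ 0) / f := by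
    have hγ : (γ : GL (Fin 2) ℝ) ∈ 𝒮ℒ := ⟨γ, rfl⟩
    simp_rw [div_slash_SL2, SL_slash, SlashInvariantForm.slash_action_eqn _ _ hγ]
  let g : ModularForm 𝒮ℒ (0 - k) :=
    { toFun := (1 : ModularForm 𝒮ℒ 0) / f
      slash_action_eq' := fun _ ⟨γ, hγ⟩ ↦ hγ ▸ hslash γ
      holo' := (1 : ModularForm 𝒮ℒ 0).holo'.div f.holo' hne
      bdd_at_cusps' {c} hc := by
        rw [Subgroup.IsArithmetic.isCusp_iff_isCusp_SL2Z] at hc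
        rw [OnePoint.isBoundedAt_iff_forall_SL2Z hc]
        intro γ _
        rw [hslash γ, IsBoundedAtImInfty, BoundedAtFilter]
        exact ((tendsto_const_nhds (x := (1 : ℂ))).div hf ‹_›).isBigO_one ℝ }
  have hg : (g : ℍ → ℂ) = 0 := levelOne_neg_weight_eq_zero (by lia) g
  have hI : (1 : ℂ) / f I = 0 := congr_fun hg I
  exact div_ne_zero one_ne_zero (hne I) hI

lemma tendsto_E_atImInfty {k : ℕ} (hk : 3 ≤ k) (hk' : Even k) :
    Tendsto (E hk) atImInfty (𝓝 1) := by
  rw [← E_qExpansion_coeff_zero hk hk']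
  exact tendsto_atImInfty_qExpansion_coeff_zero (E hk)

lemma exists_mul_E₄_cube_eq_mul_E₆_sq {A B : ℂ} (h : A ≠ B) :
    ∃ τ : ℍ, A * E₄ τ ^ 3 = B * E₆ τ ^ 2 := by
  let f : ModularForm 𝒮ℒ 12 := A • ModularForm.mcast (by decide) (E₄.pow 3) -
    B • ModularForm.mcast (by decide) (E₆.pow 2)
  have hf (τ : ℍ) : f τ = A * E₄ τ ^ 3 - B * E₆ τ ^ 2 := by
    simp only [f, coe_mcast, ModularForm.coe_pow, sub_apply, Pi.pow_apply,
      smul_apply, smul_eq_mul]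
  have hlim : Tendsto f atImInfty (𝓝 (A - B)) := by
    have h₄ : Tendsto E₄ atImInfty (𝓝 1) := tendsto_E_atImInfty _ ⟨2, rfl⟩
    have h₆ : Tendsto E₆ atImInfty (𝓝 1) := tendsto_E_atImInfty _ ⟨3, rfl⟩
    have := ((h₄.pow 3).const_mul A).sub ((h₆.pow 2).const_mul B)
    simp only [one_pow, mul_one] at this
    exact this.congr fun τ ↦ (hf τ).symm
  obtain ⟨τ, hτ⟩ := exists_zero_of_tendsto_atImInfty (by norm_num) f (sub_ne_zero.mpr h) hlim
  exact ⟨τ, sub_eq_zero.mp ((hf τ).symm.trans hτ)⟩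

lemma E₄_ne_zero_or_E₆_ne_zero (τ : ℍ) : E₄ τ ≠ 0 ∨ E₆ τ ≠ 0 := by
  by_contra! h
  apply ModularForm.discriminant_ne_zero τ
  rw [ModularForm.discriminant_eq_E₄_cube_sub_E₆_sq, h.1, h.2]
  norm_num

/-- The lattice `c (ℤ τ + ℤ)`, whose invariants are multiples of the Eisenstein series at `τ`. -/
def scaledPeriodPair (τ : ℍ) (c : ℂ) (hc : c ≠ 0) : PeriodPair where
  ω₁ := c * τ
  ω₂ := c
  indep := by
    rw [LinearIndependent.pair_iff]
    intro s t h
    have hst : (s : ℂ) * τ + t = 0 := by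
      refine (mul_eq_zero.mp (?_ : c * ((s : ℂ) * τ + t) = 0)).resolve_left hc
      simp only [Complex.real_smul] at h
      linear_combination h
    have him : s * τ.im = 0 := by simpa using congr_arg Complex.im hst
    obtain rfl : s = 0 := (mul_eq_zero.mp him).resolve_right τ.im_ne_zero
    simpa using hst

lemma coe_latticeEquivProd_symm_scaledPeriodPair (τ : ℍ) {c : ℂ} (hc : c ≠ 0) (x : ℤ × ℤ) :
    ((scaledPeriodPair τ c hc).latticeEquivProd.symm x : ℂ) = c * (x.1 * τ + x.2) := by
  rw [PeriodPair.latticeEquiv_symm_apply]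
  simp only [scaledPeriodPair]
  ring

lemma G_scaledPeriodPair (τ : ℍ) {c : ℂ} (hc : c ≠ 0) {k : ℕ} (hk : 3 ≤ k) :
    (scaledPeriodPair τ c hc).G k = (c ^ k)⁻¹ * (2 * riemannZeta k * E hk τ) := by
  have hE : E hk τ = 1 / 2 * eisensteinSeries (N := 1) 0 k τ := rfl
  have hsum : 2 * riemannZeta k * E hk τ = ∑' v : Fin 2 → ℤ, eisSummand k v τ := by
    rw [tsum_eisSummand_eq_riemannZeta_mul_eisensteinSeries hk, hE]
    ring
  rw [hsum, ← tsum_mul_left, PeriodPair.G, ← ((finTwoArrowEquiv ℤ).trans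
    (scaledPeriodPair τ c hc).latticeEquivProd.symm.toEquiv).tsum_eq]
  refine tsum_congr fun v ↦ ?_
  have hv : ((((finTwoArrowEquiv ℤ).trans (scaledPeriodPair τ c hc).latticeEquivProd.symm.toEquiv) v
      : (scaledPeriodPair τ c hc).lattice) : ℂ) = c * (v 0 * τ + v 1) :=
    coe_latticeEquivProd_symm_scaledPeriodPair τ hc (v 0, v 1)
  rw [hv, eisSummand, zpow_neg, zpow_natCast, mul_pow, mul_inv]

lemma riemannZeta_six : riemannZeta 6 = Real.pi ^ 6 / 945 := by
  have hbernoulli : bernoulli (2 * 3) = 1 / 42 := by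
    have h5 : bernoulli' 5 = 0 := bernoulli'_eq_zero_of_odd ⟨2, rfl⟩ (by norm_num)
    rw [bernoulli_eq_bernoulli'_of_ne_one (by norm_num), bernoulli'_def]
    norm_num [Finset.sum_range_succ, h5, Nat.choose]
  have h := riemannZeta_two_mul_nat (k := 3) (by norm_num)
  rw [hbernoulli] at h
  norm_num [Nat.factorial] at h
  rw [h]
  ring

lemma g₂_scaledPeriodPair (τ : ℍ) {c : ℂ} (hc : c ≠ 0) :
    (scaledPeriodPair τ c hc).g₂ = (c ^ 4)⁻¹ * (4 / 3 * Real.pi ^ 4 * E₄ τ) := by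
  rw [PeriodPair.g₂, G_scaledPeriodPair τ hc (by norm_num), Nat.cast_ofNat, riemannZeta_four]
  ring

lemma g₃_scaledPeriodPair (τ : ℍ) {c : ℂ} (hc : c ≠ 0) :
    (scaledPeriodPair τ c hc).g₃ = (c ^ 6)⁻¹ * (8 / 27 * Real.pi ^ 6 * E₆ τ) := by
  rw [PeriodPair.g₃, G_scaledPeriodPair τ hc (by norm_num), Nat.cast_ofNat, riemannZeta_six]
  ring

lemma exists_sq_mul_eq_and_cube_mul_eq {K : Type*} [Field K] [IsAlgClosed K] {α β u v : K}
    (hαβ : α ≠ 0 ∨ β ≠ 0) (huv : u ≠ 0 ∨ v ≠ 0) (h : β ^ 2 * u ^ 3 = α ^ 3 * v ^ 2) :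
    ∃ m : K, m ^ 2 * α = u ∧ m ^ 3 * β = v := by
  rcases eq_or_ne α 0 with rfl | hα
  · have hβ : β ≠ 0 := hαβ.resolve_left (not_not_intro rfl)
    have hu : u = 0 := by simpa [hβ] using h
    obtain ⟨m, hm⟩ := IsAlgClosed.exists_pow_nat_eq (v / β) three_pos
    exact ⟨m, by rw [hu, mul_zero], by rw [hm, div_mul_cancel₀ v hβ]⟩
  rcases eq_or_ne β 0 with rfl | hβ
  · have hv : v = 0 := by simpa [hα] using h
    obtain ⟨m, hm⟩ := IsAlgClosed.exists_pow_nat_eq (u / α) two_pos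
    exact ⟨m, by rw [hm, div_mul_cancel₀ u hα], by rw [hv, mul_zero]⟩
  have hu : u ≠ 0 := by
    rintro rfl
    exact huv.elim (· rfl) (· (by simpa [hα] using h))
  refine ⟨α * v / (β * u), ?_, ?_⟩
  · field_simp
    linear_combination -h
  · field_simp
    linear_combination -v * h

theorem exists_periodPair_of_discriminant_ne_zero {α β : ℂ} (h : α ^ 3 ≠ 27 * β ^ 2) :
    ∃ L : PeriodPair, L.g₂ = α ∧ L.g₃ = β := by
  have hπ : (Real.pi : ℂ) ≠ 0 := Complex.ofReal_ne_zero.mpr Real.pi_ne_zero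
  obtain ⟨τ, hτ⟩ := exists_mul_E₄_cube_eq_mul_E₆_sq h.symm
  have hαβ : α ≠ 0 ∨ β ≠ 0 := by
    by_contra! h0
    simp [h0.1, h0.2] at h
  have hE : 4 / 3 * Real.pi ^ 4 * E₄ τ ≠ 0 ∨ 8 / 27 * Real.pi ^ 6 * E₆ τ ≠ 0 := by
    simpa [hπ] using E₄_ne_zero_or_E₆_ne_zero τ
  obtain ⟨m, hm₂, hm₃⟩ := exists_sq_mul_eq_and_cube_mul_eq hαβ hE
    (by linear_combination (64 / 729 * Real.pi ^ 12 : ℂ) * hτ)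
  obtain ⟨c, rfl⟩ := IsAlgClosed.exists_pow_nat_eq m two_pos
  have hc : c ≠ 0 := by
    rintro rfl
    simp [← hm₂, ← hm₃] at hE
  refine ⟨scaledPeriodPair τ c hc, ?_, ?_⟩
  · rw [g₂_scaledPeriodPair, ← hm₂]
    field_simp
  · rw [g₃_scaledPeriodPair, ← hm₃]
    field_simp

end Lattices

/-! ### Ordinary differential equations and continuation along the line -/

section Continuation

lemma eqOn_of_eventuallyEq {X Y : Type*} [TopologicalSpace X] [TopologicalSpace Y] [T2Space Y]
    {f g : X → Y} {I : Set X} (hI : IsPreconnected I) (hf : ∀ t ∈ I, ContinuousAt f t)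
    (hg : ∀ t ∈ I, ContinuousAt g t) (hloc : ∀ t ∈ I, f t = g t → f =ᶠ[𝓝 t] g) {t₀ : X}
    (ht₀ : t₀ ∈ I) (h : f t₀ = g t₀) : Set.EqOn f g I := by
  have hopen : IsOpen {t | f =ᶠ[𝓝 t] g} := isOpen_setOfPred_eventually_nhds
  have hsub : I ⊆ {t | f =ᶠ[𝓝 t] g} := by
    refine hI.subset_of_closure_inter_subset hopen ⟨t₀, ht₀, hloc t₀ ht₀ h⟩ ?_
    rintro t ⟨ht, htI⟩
    refine hloc t htI (tendsto_nhds_unique_of_frequently_eq (hf t htI) (hg t htI) ?_)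
    exact (mem_closure_iff_frequently.mp ht).mono fun _ hs ↦ hs.eq_of_nhds
  exact fun t ht ↦ (hsub ht).eq_of_nhds

lemma eq_of_comp_eq_of_hasStrictDerivAt {X 𝕜 : Type*} [TopologicalSpace X] [PreconnectedSpace X]
    [NontriviallyNormedField 𝕜] [CompleteSpace 𝕜] {F : 𝕜 → 𝕜} {p q : X → 𝕜} (hp : Continuous p)
    (hq : Continuous q) (hF : ∀ t, F (p t) = F (q t))
    (hF' : ∀ t, ∃ F' ≠ 0, HasStrictDerivAt F F' (p t)) {t₀ : X} (h : p t₀ = q t₀) : p = q := by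
  refine Set.eqOn_univ p q |>.mp (eqOn_of_eventuallyEq isPreconnected_univ
    (fun t _ ↦ hp.continuousAt) (fun t _ ↦ hq.continuousAt) (fun t _ ht ↦ ?_) (Set.mem_univ t₀) h)
  obtain ⟨F', hF'0, hs⟩ := hF' t
  have hinv : ∀ᶠ z in 𝓝 (p t), hs.localInverse F F' (p t) hF'0 (F z) = z :=
    HasStrictFDerivAt.eventually_left_inverse _
  have hqt : Tendsto q (𝓝 t) (𝓝 (p t)) := ht ▸ hq.continuousAt
  filter_upwards [hp.continuousAt.eventually hinv, hqt.eventually hinv] with u hpu hqu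
  rw [← hpu, ← hqu, hF u]

lemma eventuallyEq_of_eventually_nhdsNE_ne_neg {r s : ℝ → ℝ} (hr : Continuous r)
    (hs : Continuous s) (hsq : ∀ t, s t ^ 2 = r t ^ 2) {t : ℝ} (h : ∀ᶠ u in 𝓝[≠] t, s u ≠ -r u) :
    s =ᶠ[𝓝 t] r := by
  rw [← hs.continuousAt.eventuallyEq_nhds_iff_eventuallyEq_nhdsNE hr.continuousAt]
  filter_upwards [h] with u hu
  exact (sq_eq_sq_iff_eq_or_eq_neg.mp (hsq u)).resolve_right hu

lemma eventuallyEq_or_eventuallyEq_neg_of_sq_eq_sq {r s : ℝ → ℝ} (hr : Differentiable ℝ r)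
    (hs : Differentiable ℝ s) (hsq : ∀ t, s t ^ 2 = r t ^ 2) {t : ℝ}
    (hsimple : r t = 0 → deriv r t ≠ 0) : s =ᶠ[𝓝 t] r ∨ s =ᶠ[𝓝 t] -r := by
  have hcase : (∀ᶠ u in 𝓝[≠] t, s u ≠ -r u) ∨ ∀ᶠ u in 𝓝[≠] t, s u ≠ r u := by
    by_cases h0 : r t = 0
    · by_cases hd : deriv s t = deriv r t
      · left
        have hadd := (hs t).hasDerivAt.fun_add (hr t).hasDerivAt
        filter_upwards [hadd.eventually_ne (c := 0) (by simp [hd, hsimple h0])] with u hu huv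
        exact hu (by rw [huv, neg_add_cancel])
      · right
        have hsub := (hs t).hasDerivAt.fun_sub (hr t).hasDerivAt
        filter_upwards [hsub.eventually_ne (c := 0) (sub_ne_zero.mpr hd)] with u hu huv
        exact hu (by rw [huv, sub_self])
    · rcases sq_eq_sq_iff_eq_or_eq_neg.mp (hsq t) with h | h
      · exact .inl <| eventually_nhdsWithin_of_eventually_nhds <|
          (isOpen_ne_fun hs.continuous hr.continuous.fun_neg).mem_nhds (x := t)
            (show s t ≠ -r t by rw [h]; exact mt self_eq_neg.mp h0)
      · exact .inr <| eventually_nhdsWithin_of_eventually_nhds <|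
          (isOpen_ne_fun hs.continuous hr.continuous).mem_nhds (x := t)
            (show s t ≠ r t by rw [h]; exact mt neg_eq_self.mp h0)
  refine hcase.imp (eventuallyEq_of_eventually_nhdsNE_ne_neg hr.continuous hs.continuous hsq)
    fun h ↦ eventuallyEq_of_eventually_nhdsNE_ne_neg hr.continuous.neg hs.continuous
      (by simpa using hsq) (by simpa using h)

lemma eq_of_sq_eq_sq_of_deriv_ne_zero {r s : ℝ → ℝ} (hr : Differentiable ℝ r)
    (hs : Differentiable ℝ s) (hsq : ∀ t, s t ^ 2 = r t ^ 2)
    (hsimple : ∀ t, r t = 0 → deriv r t ≠ 0) {t₀ : ℝ} (h : s t₀ = r t₀) (h' : r t₀ ≠ 0) :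
    s = r := by
  have hdisj : Disjoint {t | s =ᶠ[𝓝 t] r} {t | s =ᶠ[𝓝 t] -r} := by
    refine Set.disjoint_left.mpr fun t (ht : s =ᶠ[𝓝 t] r) (ht' : s =ᶠ[𝓝 t] -r) ↦ ?_
    have hr0 : r =ᶠ[𝓝 t] fun _ ↦ 0 := by
      filter_upwards [ht, ht'] with u hu hu'
      exact self_eq_neg.mp (hu.symm.trans hu')
    exact hsimple t hr0.eq_of_nhds (by rw [hr0.deriv_eq, deriv_const])
  have hsub := isPreconnected_univ.subset_left_of_subset_union
    (isOpen_setOfPred_eventually_nhds (p := fun t ↦ s t = r t))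
    (isOpen_setOfPred_eventually_nhds (p := fun t ↦ s t = (-r) t)) hdisj
    (fun t _ ↦ eventuallyEq_or_eventuallyEq_neg_of_sq_eq_sq hr hs hsq (hsimple t))
    ⟨t₀, Set.mem_univ t₀, (eventuallyEq_or_eventuallyEq_neg_of_sq_eq_sq hr hs hsq
      (hsimple t₀)).resolve_right fun hneg ↦ h' (self_eq_neg.mp (h.symm.trans hneg.eq_of_nhds))⟩
  exact funext fun t ↦ (hsub (Set.mem_univ t)).self_of_nhds

end Continuation

section ODE

variable {E : Type*} [NormedAddCommGroup E] [NormedSpace ℝ E]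

lemma exists_integralCurveOn_Ioo_of_lipschitzWith [CompleteSpace E] {F : E → E} {K : NNReal}
    (hF : LipschitzWith K F) (x : E) :
    ∃ f : ℝ → E, f 0 = x ∧
      ∀ t ∈ Set.Ioo (-(1 + K : ℝ)⁻¹) (1 + K : ℝ)⁻¹, HasDerivAt f (F (f t)) t := by
  set ε : ℝ := (1 + K : ℝ)⁻¹ with hε
  have hε0 : 0 < ε := by positivity
  have hpl : IsPicardLindelof (fun _ ↦ F)
      (⟨0, by constructor <;> linarith⟩ : Set.Icc (-ε) ε) x ‖F x‖₊ 0 ((1 + K) * ‖F x‖₊) K := by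
    refine ⟨fun _ _ ↦ hF.lipschitzOnWith, fun _ _ ↦ continuousOn_const, fun _ _ y hy ↦ ?_, ?_⟩
    · calc ‖F y‖ ≤ ‖F x‖ + ‖F y - F x‖ := norm_le_norm_add_norm_sub' _ _
        _ ≤ ‖F x‖ + K * ‖F x‖ := by
          gcongr
          rw [← dist_eq_norm]
          exact (hF.dist_le_mul y x).trans (by gcongr; exact hy)
        _ = (1 + K) * ‖F x‖ := by ring
    · have : (1 + K : ℝ) * ‖F x‖ * ε = ‖F x‖ := by rw [hε]; field_simp
      simpa using this.le
  obtain ⟨f, hf0, hf⟩ := hpl.exists_eq_forall_mem_Icc_hasDerivWithinAt₀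
  exact ⟨f, hf0, fun t ht ↦ (hf t (Set.Ioo_subset_Icc_self ht)).hasDerivAt
    (Icc_mem_nhds ht.1 ht.2)⟩

open scoped Manifold in
theorem exists_integralCurve_of_lipschitzWith [CompleteSpace E] {F : E → E} {K : NNReal}
    (hF : LipschitzWith K F) (hF' : ContDiff ℝ 1 F) (x : E) :
    ∃ f : ℝ → E, f 0 = x ∧ ∀ t, HasDerivAt f (F (f t)) t := by
  have hpos : 0 < (1 + K : ℝ)⁻¹ := by positivity
  obtain ⟨f, hf0, hf⟩ := exists_isMIntegralCurve_of_isMIntegralCurveOn (I := 𝓘(ℝ, E)) (M := E)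
    (v := F) (contMDiff_vectorSpace_iff_contDiff.mpr hF') hpos (fun y ↦ by
      obtain ⟨f, hf0, hf⟩ := exists_integralCurveOn_Ioo_of_lipschitzWith hF y
      exact ⟨f, hf0, fun t ht ↦ (hf t ht).hasFDerivAt.hasMFDerivAt.hasMFDerivWithinAt⟩) x
  refine ⟨f, hf0, fun t ↦ ?_⟩
  have h : HasFDerivAt f ((1 : ℝ →L[ℝ] ℝ).smulRight (F (f t))) t := (hf t).hasFDerivAt
  simpa using h.hasDerivAt

lemma eventuallyEq_of_hasDerivAt_smul {𝕜 : Type*} [NormedField 𝕜] [NormedSpace 𝕜 E] {F : E → E}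
    (hF : LocallyLipschitz F) {w : ℝ → 𝕜} {f g : ℝ → E} {t₀ : ℝ} (hw : ContinuousAt w t₀)
    (hf : ∀ᶠ t in 𝓝 t₀, HasDerivAt f (w t • F (f t)) t)
    (hg : ∀ᶠ t in 𝓝 t₀, HasDerivAt g (w t • F (g t)) t) (h : f t₀ = g t₀) : f =ᶠ[𝓝 t₀] g := by
  obtain ⟨K, U, hU, hK⟩ := hF (f t₀)
  have hlip : ∀ᶠ t in 𝓝 t₀, LipschitzOnWith ((‖w t₀‖₊ + 1) * K) (fun q ↦ w t • F q) U := by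
    filter_upwards [hw.nnnorm.eventually (gt_mem_nhds (lt_add_one _))] with t ht
    refine LipschitzOnWith.of_dist_le_mul fun q hq r hr ↦ ?_
    rw [dist_smul₀, NNReal.coe_mul, mul_assoc]
    gcongr
    · exact_mod_cast ht.le
    · exact hK.dist_le_mul q hq r hr
  exact ODE_solution_unique_of_eventually (v := fun t q ↦ w t • F q) (s := fun _ ↦ U) hlip
    (hf.and (hf.self_of_nhds.continuousAt.eventually_mem hU))
    (hg.and (hg.self_of_nhds.continuousAt.eventually_mem (h ▸ hU))) h

end ODE

/-! ### The equation of motion across the ridge -/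

section Reduced

lemma depth_pos {a b : ℝ} (ha : 0 < a) (hb : 0 < b) (x y : ℝ) : 0 < depth a b x y := by
  unfold depth; positivity

lemma depth_eq_one_add {a : ℝ} (ha : 0 < a) (b x y : ℝ) :
    depth a b x y = 1 + (b - a) * (x ^ 2 + a)⁻¹ := by
  have : x ^ 2 + a ≠ 0 := by positivity
  unfold depth; field_simp; ring

lemma hasDerivAt_depth {a : ℝ} (ha : 0 < a) (b x y : ℝ) :
    HasDerivAt (fun u ↦ depth a b u y) (2 * ((a - b) * x / (x ^ 2 + a) ^ 2)) x := by
  have h0 : x ^ 2 + a ≠ 0 := by positivity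
  refine (((hasDerivAt_pow 2 x).add_const b).fun_div
    ((hasDerivAt_pow 2 x).add_const a) h0).congr_deriv ?_
  field_simp
  push_cast
  ring

/-- The force `½ (D - κ D²)'(x)` governing the first coordinate of a trajectory: here
`κ = p₂² / H²` is a constant of motion, and `ẋ₁² = D - κ D²`. -/
noncomputable def acceleration (a b κ x : ℝ) : ℝ :=
  (a - b) * x / (x ^ 2 + a) ^ 2 * (1 - 2 * κ * depth a b x 0)

lemma hasDerivAt_depth_sub_mul_depth_sq {a : ℝ} (ha : 0 < a) (b κ x : ℝ) :
    HasDerivAt (fun u ↦ depth a b u 0 - κ * depth a b u 0 ^ 2) (2 * acceleration a b κ x) x := by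
  have hD := hasDerivAt_depth ha b x 0
  refine (hD.fun_sub ((hD.fun_pow 2).const_mul κ)).congr_deriv ?_
  simp only [acceleration]
  push_cast
  ring

lemma hasDerivAt_acceleration {a : ℝ} (ha : 0 < a) (b κ x : ℝ) :
    HasDerivAt (acceleration a b κ)
      ((a - b) * ((1 - 2 * κ) * (4 * a * (x ^ 2 + a)⁻¹ ^ 3 - 3 * (x ^ 2 + a)⁻¹ ^ 2) -
        2 * κ * (b - a) * (6 * a * (x ^ 2 + a)⁻¹ ^ 4 - 5 * (x ^ 2 + a)⁻¹ ^ 3))) x := by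
  have h0 : x ^ 2 + a ≠ 0 := by positivity
  have hfrac := ((hasDerivAt_id' x).const_mul (a - b)).fun_div
    (((hasDerivAt_pow 2 x).add_const a).fun_pow 2) (pow_ne_zero 2 h0)
  refine (hfrac.fun_mul
    (((hasDerivAt_depth ha b x 0).const_mul (2 * κ)).const_sub 1)).congr_deriv ?_
  rw [depth_eq_one_add ha]
  field_simp
  push_cast
  ring

lemma exists_lipschitzWith_acceleration {a : ℝ} (ha : 0 < a) (b κ : ℝ) :
    ∃ K, LipschitzWith K (acceleration a b κ) := by
  obtain ⟨C, hC⟩ := (isCompact_Icc (a := (0 : ℝ)) (b := a⁻¹)).exists_bound_of_continuousOn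
    (f := fun w ↦ (a - b) * ((1 - 2 * κ) * (4 * a * w ^ 3 - 3 * w ^ 2) -
      2 * κ * (b - a) * (6 * a * w ^ 4 - 5 * w ^ 3))) (by fun_prop)
  refine ⟨C.toNNReal, lipschitzWith_of_nnnorm_deriv_le
    (fun x ↦ (hasDerivAt_acceleration ha b κ x).differentiableAt) fun x ↦ ?_⟩
  rw [(hasDerivAt_acceleration ha b κ x).deriv]
  exact NNReal.le_toNNReal_of_coe_le
    (hC (x ^ 2 + a)⁻¹ ⟨by positivity, inv_anti₀ ha (by linarith [sq_nonneg x])⟩)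

/-- The vector field on the phase plane of the second order equation `ẍ = ½ (D - κ D²)'(x)`. -/
noncomputable def reducedField (a b κ : ℝ) (q : ℝ × ℝ) : ℝ × ℝ := (q.2, acceleration a b κ q.1)

lemma exists_lipschitzWith_reducedField {a : ℝ} (ha : 0 < a) (b κ : ℝ) :
    ∃ K, LipschitzWith K (reducedField a b κ) := by
  obtain ⟨K, hK⟩ := exists_lipschitzWith_acceleration ha b κ
  exact ⟨_, LipschitzWith.prod_snd.prodMk (hK.comp LipschitzWith.prod_fst)⟩

lemma contDiff_reducedField {a : ℝ} (ha : 0 < a) (b κ : ℝ) :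
    ContDiff ℝ 1 (reducedField a b κ) := by
  have h0 (x : ℝ) : x ^ 2 + a ≠ 0 := by positivity
  have hacc : ContDiff ℝ 1 (acceleration a b κ) := by
    unfold acceleration depth
    fun_prop (disch := simp [h0])
  exact contDiff_snd.prodMk (hacc.comp contDiff_fst)

/-- `x` is a solution, with velocity `v`, of `ẍ = ½ (D - κ D²)'(x)` on the time set `I`. -/
structure IsReducedSolutionOn (a b κ : ℝ) (I : Set ℝ) (x v : ℝ → ℝ) : Prop where
  x_dot : ∀ t ∈ I, HasDerivAt x (v t) t
  v_dot : ∀ t ∈ I, HasDerivAt v (acceleration a b κ (x t)) t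

theorem exists_isReducedSolutionOn_univ {a : ℝ} (ha : 0 < a) (b κ x₀ v₀ : ℝ) :
    ∃ x v : ℝ → ℝ, x 0 = x₀ ∧ v 0 = v₀ ∧ IsReducedSolutionOn a b κ Set.univ x v := by
  obtain ⟨K, hK⟩ := exists_lipschitzWith_reducedField ha b κ
  obtain ⟨f, hf0, hf⟩ :=
    exists_integralCurve_of_lipschitzWith hK (contDiff_reducedField ha b κ) (x₀, v₀)
  exact ⟨fun t ↦ (f t).1, fun t ↦ (f t).2, by simp only [hf0], by simp only [hf0],
    fun t _ ↦ (hf t).fst, fun t _ ↦ (hf t).snd⟩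

namespace IsReducedSolutionOn

variable {a b κ : ℝ} {I : Set ℝ} {x v y w : ℝ → ℝ}

theorem eqOn (ha : 0 < a) (hI : IsOpen I) (hI' : IsPreconnected I)
    (hx : IsReducedSolutionOn a b κ I x v) (hy : IsReducedSolutionOn a b κ I y w) {t₀ : ℝ}
    (ht₀ : t₀ ∈ I) (hxy : x t₀ = y t₀) (hvw : v t₀ = w t₀) : Set.EqOn x y I ∧ Set.EqOn v w I := by
  obtain ⟨K, hK⟩ := exists_lipschitzWith_reducedField ha b κ
  have hderiv {x v : ℝ → ℝ} (hx : IsReducedSolutionOn a b κ I x v) (t : ℝ) (ht : t ∈ I) :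
      HasDerivAt (fun t ↦ (x t, v t)) (reducedField a b κ (x t, v t)) t :=
    (hx.x_dot t ht).prodMk (hx.v_dot t ht)
  have heq : Set.EqOn (fun t ↦ (x t, v t)) (fun t ↦ (y t, w t)) I := by
    refine eqOn_of_eventuallyEq hI' (fun t ht ↦ (hderiv hx t ht).continuousAt)
      (fun t ht ↦ (hderiv hy t ht).continuousAt) (fun t ht h ↦ ?_) ht₀ (Prod.ext hxy hvw)
    refine eventuallyEq_of_hasDerivAt_smul (w := fun _ ↦ (1 : ℝ)) hK.locallyLipschitz
      continuousAt_const ?_ ?_ h <;> filter_upwards [hI.mem_nhds ht] with s hs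
    · simpa using hderiv hx s hs
    · simpa using hderiv hy s hs
  exact ⟨fun t ht ↦ (Prod.ext_iff.mp (heq ht)).1, fun t ht ↦ (Prod.ext_iff.mp (heq ht)).2⟩

theorem sq_eq (ha : 0 < a) (hx : IsReducedSolutionOn a b κ Set.univ x v) {t₀ : ℝ}
    (h₀ : v t₀ ^ 2 = depth a b (x t₀) 0 - κ * depth a b (x t₀) 0 ^ 2) (t : ℝ) :
    v t ^ 2 = depth a b (x t) 0 - κ * depth a b (x t) 0 ^ 2 := by
  have hd (t : ℝ) : HasDerivAt
      (fun t ↦ v t ^ 2 - (depth a b (x t) 0 - κ * depth a b (x t) 0 ^ 2)) 0 t := by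
    refine (((hx.v_dot t trivial).fun_pow 2).fun_sub
      ((hasDerivAt_depth_sub_mul_depth_sq ha b κ (x t)).comp t (hx.x_dot t trivial))).congr_deriv ?_
    push_cast
    ring
  have := is_const_of_deriv_eq_zero (fun t ↦ (hd t).differentiableAt) (fun t ↦ (hd t).deriv) t t₀
  linarith

end IsReducedSolutionOn

end Reduced

/-! ### Reduction of the Hamiltonian system -/

section Hamiltonian

variable {a b : ℝ}

lemma hamiltonian_eq_sqrt (x₁ x₂ p₁ p₂ : ℝ) :
    hamiltonian a b x₁ x₂ p₁ p₂ = √((p₁ ^ 2 + p₂ ^ 2) * depth a b x₁ x₂) :=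
  (Real.sqrt_mul (by positivity) _).symm

lemma sq_add_sq_mul_depth_pos (ha : 0 < a) (hb : 0 < b) (x₁ x₂ : ℝ) {p₁ p₂ : ℝ}
    (hp : ¬ (p₁ = 0 ∧ p₂ = 0)) : 0 < (p₁ ^ 2 + p₂ ^ 2) * depth a b x₁ x₂ := by
  refine mul_pos ?_ (depth_pos ha hb x₁ x₂)
  rcases not_and_or.mp hp with h | h <;> positivity

lemma hamiltonian_pos (ha : 0 < a) (hb : 0 < b) (x₁ x₂ : ℝ) {p₁ p₂ : ℝ}
    (hp : ¬ (p₁ = 0 ∧ p₂ = 0)) : 0 < hamiltonian a b x₁ x₂ p₁ p₂ := by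
  rw [hamiltonian_eq_sqrt]
  exact Real.sqrt_pos.mpr (sq_add_sq_mul_depth_pos ha hb x₁ x₂ hp)

lemma hamiltonian_sq (ha : 0 < a) (hb : 0 < b) (x₁ x₂ p₁ p₂ : ℝ) :
    hamiltonian a b x₁ x₂ p₁ p₂ ^ 2 = (p₁ ^ 2 + p₂ ^ 2) * depth a b x₁ x₂ := by
  rw [hamiltonian_eq_sqrt, Real.sq_sqrt]
  have := depth_pos ha hb x₁ x₂
  positivity

lemma deriv_hamiltonian_p₁ (ha : 0 < a) (hb : 0 < b) (x₁ x₂ : ℝ) {p₁ p₂ : ℝ}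
    (hp : ¬ (p₁ = 0 ∧ p₂ = 0)) :
    deriv (fun u ↦ hamiltonian a b x₁ x₂ u p₂) p₁ =
      p₁ * depth a b x₁ 0 / hamiltonian a b x₁ x₂ p₁ p₂ := by
  simp only [hamiltonian_eq_sqrt]
  refine (((((hasDerivAt_pow 2 p₁).add_const (p₂ ^ 2)).mul_const (depth a b x₁ x₂)).sqrt
    (sq_add_sq_mul_depth_pos ha hb x₁ x₂ hp).ne').congr_deriv ?_).deriv
  simp only [depth]
  push_cast
  ring

lemma deriv_hamiltonian_p₂ (ha : 0 < a) (hb : 0 < b) (x₁ x₂ : ℝ) {p₁ p₂ : ℝ}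
    (hp : ¬ (p₁ = 0 ∧ p₂ = 0)) :
    deriv (fun u ↦ hamiltonian a b x₁ x₂ p₁ u) p₂ =
      p₂ * depth a b x₁ 0 / hamiltonian a b x₁ x₂ p₁ p₂ := by
  simp only [hamiltonian_eq_sqrt]
  refine (((((hasDerivAt_pow 2 p₂).const_add (p₁ ^ 2)).mul_const (depth a b x₁ x₂)).sqrt
    (sq_add_sq_mul_depth_pos ha hb x₁ x₂ hp).ne').congr_deriv ?_).deriv
  simp only [depth]
  push_cast
  ring

lemma deriv_hamiltonian_x₁ (ha : 0 < a) (hb : 0 < b) (x₁ x₂ : ℝ) {p₁ p₂ : ℝ}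
    (hp : ¬ (p₁ = 0 ∧ p₂ = 0)) :
    deriv (fun u ↦ hamiltonian a b u x₂ p₁ p₂) x₁ =
      (p₁ ^ 2 + p₂ ^ 2) * ((a - b) * x₁ / (x₁ ^ 2 + a) ^ 2) /
        hamiltonian a b x₁ x₂ p₁ p₂ := by
  simp only [hamiltonian_eq_sqrt]
  refine ((((hasDerivAt_depth ha b x₁ x₂).const_mul (p₁ ^ 2 + p₂ ^ 2)).sqrt
    (sq_add_sq_mul_depth_pos ha hb x₁ x₂ hp).ne').congr_deriv ?_).deriv
  ring

lemma deriv_hamiltonian_x₂ (x₁ x₂ p₁ p₂ : ℝ) :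
    deriv (fun u ↦ hamiltonian a b x₁ u p₁ p₂) x₂ = 0 :=
  deriv_const x₂ (√(p₁ ^ 2 + p₂ ^ 2) * √(depth a b x₁ x₂))

namespace IsSolutionOn

variable {I : Set ℝ} {x₁ x₂ p₁ p₂ y₁ y₂ q₁ q₂ : ℝ → ℝ}

lemma mono {J : Set ℝ} (hs : IsSolutionOn a b J x₁ x₂ p₁ p₂) (hIJ : I ⊆ J) :
    IsSolutionOn a b I x₁ x₂ p₁ p₂ :=
  ⟨fun t ht ↦ hs.momentum_ne_zero t (hIJ ht), fun t ht ↦ hs.x₁_dot t (hIJ ht),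
    fun t ht ↦ hs.x₂_dot t (hIJ ht), fun t ht ↦ hs.p₁_dot t (hIJ ht),
    fun t ht ↦ hs.p₂_dot t (hIJ ht)⟩

lemma hasDerivAt_sq_add_sq_mul_depth (ha : 0 < a) (hb : 0 < b)
    (hs : IsSolutionOn a b I x₁ x₂ p₁ p₂) {t : ℝ} (ht : t ∈ I) :
    HasDerivAt (fun t ↦ (p₁ t ^ 2 + p₂ t ^ 2) * depth a b (x₁ t) 0) 0 t := by
  have hp := hs.momentum_ne_zero t ht
  refine ((((hs.p₁_dot t ht).fun_pow 2).fun_add ((hs.p₂_dot t ht).fun_pow 2)).fun_mul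
    ((hasDerivAt_depth ha b (x₁ t) 0).comp t (hs.x₁_dot t ht))).congr_deriv ?_
  rw [deriv_hamiltonian_p₁ ha hb _ _ hp, deriv_hamiltonian_x₁ ha hb _ _ hp, deriv_hamiltonian_x₂]
  simp only [Function.comp]
  push_cast
  ring

lemma p₂_eq (hI : IsOpen I) (hI' : IsPreconnected I) (hs : IsSolutionOn a b I x₁ x₂ p₁ p₂)
    {t₀ t : ℝ} (ht₀ : t₀ ∈ I) (ht : t ∈ I) : p₂ t = p₂ t₀ :=
  hI.is_const_of_deriv_eq_zero hI'
    (fun s hs' ↦ (hs.p₂_dot s hs').differentiableAt.differentiableWithinAt)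
    (fun s hs' ↦ by simp only [(hs.p₂_dot s hs').deriv, deriv_hamiltonian_x₂, neg_zero,
      Pi.zero_apply]) ht ht₀

lemma hamiltonian_eq (ha : 0 < a) (hb : 0 < b) (hI : IsOpen I) (hI' : IsPreconnected I)
    (hs : IsSolutionOn a b I x₁ x₂ p₁ p₂) {t₀ t : ℝ} (ht₀ : t₀ ∈ I) (ht : t ∈ I) :
    hamiltonian a b (x₁ t) (x₂ t) (p₁ t) (p₂ t) =
      hamiltonian a b (x₁ t₀) (x₂ t₀) (p₁ t₀) (p₂ t₀) := by
  have hd (s : ℝ) (hs' : s ∈ I) := hs.hasDerivAt_sq_add_sq_mul_depth ha hb hs'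
  have hconst := hI.is_const_of_deriv_eq_zero hI'
    (fun s hs' ↦ (hd s hs').differentiableAt.differentiableWithinAt)
    (fun s hs' ↦ (hd s hs').deriv) ht ht₀
  simp only [hamiltonian_eq_sqrt]
  exact congr_arg Real.sqrt hconst

theorem isReducedSolutionOn (ha : 0 < a) (hb : 0 < b) (hs : IsSolutionOn a b I x₁ x₂ p₁ p₂)
    {γ E : ℝ} (hγ : ∀ t ∈ I, p₂ t = γ)
    (hE : ∀ t ∈ I, hamiltonian a b (x₁ t) (x₂ t) (p₁ t) (p₂ t) = E) :
    IsReducedSolutionOn a b (γ ^ 2 / E ^ 2) I x₁ fun t ↦ p₁ t * depth a b (x₁ t) 0 / E := by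
  have hx₁ (t : ℝ) (ht : t ∈ I) : HasDerivAt x₁ (p₁ t * depth a b (x₁ t) 0 / E) t :=
    (hs.x₁_dot t ht).congr_deriv
      (by rw [deriv_hamiltonian_p₁ ha hb _ _ (hs.momentum_ne_zero t ht), hE t ht])
  refine ⟨hx₁, fun t ht ↦ ?_⟩
  have hp := hs.momentum_ne_zero t ht
  have hsq := hamiltonian_sq ha hb (x₁ t) (x₂ t) (p₁ t) (p₂ t)
  have hE0 : E ≠ 0 := hE t ht ▸ (hamiltonian_pos ha hb (x₁ t) (x₂ t) hp).ne'
  refine (((hs.p₁_dot t ht).fun_mul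
    ((hasDerivAt_depth ha b (x₁ t) 0).comp t (hx₁ t ht))).div_const E).congr_deriv ?_
  have hA : x₁ t ^ 2 + a ≠ 0 := by positivity
  rw [deriv_hamiltonian_x₁ ha hb _ _ hp, hE t ht, acceleration]
  rw [hE t ht, hγ t ht, show depth a b (x₁ t) (x₂ t) = depth a b (x₁ t) 0 from rfl] at hsq
  simp only [Function.comp, hγ t ht]
  field_simp
  linear_combination -(a - b) * x₁ t * hsq

theorem eqOn (ha : 0 < a) (hb : 0 < b) (hI : IsOpen I) (hI' : IsPreconnected I)
    (hx : IsSolutionOn a b I x₁ x₂ p₁ p₂) (hy : IsSolutionOn a b I y₁ y₂ q₁ q₂) {t₀ : ℝ}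
    (ht₀ : t₀ ∈ I) (h₁ : x₁ t₀ = y₁ t₀) (h₂ : x₂ t₀ = y₂ t₀) (h₃ : p₁ t₀ = q₁ t₀)
    (h₄ : p₂ t₀ = q₂ t₀) :
    Set.EqOn x₁ y₁ I ∧ Set.EqOn x₂ y₂ I ∧ Set.EqOn p₁ q₁ I ∧ Set.EqOn p₂ q₂ I := by
  set E := hamiltonian a b (x₁ t₀) (x₂ t₀) (p₁ t₀) (p₂ t₀) with hEdef
  have hE0 : E ≠ 0 := (hamiltonian_pos ha hb _ _ (hx.momentum_ne_zero t₀ ht₀)).ne'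
  have hEx (t : ℝ) (ht : t ∈ I) := hx.hamiltonian_eq ha hb hI hI' ht₀ ht
  have hEy (t : ℝ) (ht : t ∈ I) : hamiltonian a b (y₁ t) (y₂ t) (q₁ t) (q₂ t) = E := by
    rw [hEdef, h₁, h₂, h₃, h₄]
    exact hy.hamiltonian_eq ha hb hI hI' ht₀ ht
  have hp₂ (t : ℝ) (ht : t ∈ I) : p₂ t = p₂ t₀ := hx.p₂_eq hI hI' ht₀ ht
  have hq₂ (t : ℝ) (ht : t ∈ I) : q₂ t = p₂ t₀ := h₄ ▸ hy.p₂_eq hI hI' ht₀ ht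
  obtain ⟨hxy, hvw⟩ := (hx.isReducedSolutionOn ha hb hp₂ hEx).eqOn ha hI hI'
    (hy.isReducedSolutionOn ha hb hq₂ hEy) ht₀ h₁ (by simp only [h₁, h₃])
  refine ⟨hxy, ?_, fun t ht ↦ ?_, fun t ht ↦ (hp₂ t ht).trans (hq₂ t ht).symm⟩
  · refine hI.eqOn_of_deriv_eq hI'
      (fun t ht ↦ (hx.x₂_dot t ht).differentiableAt.differentiableWithinAt)
      (fun t ht ↦ (hy.x₂_dot t ht).differentiableAt.differentiableWithinAt) (fun t ht ↦ ?_) ht₀ h₂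
    rw [(hx.x₂_dot t ht).deriv, (hy.x₂_dot t ht).deriv,
      deriv_hamiltonian_p₂ ha hb _ _ (hx.momentum_ne_zero t ht),
      deriv_hamiltonian_p₂ ha hb _ _ (hy.momentum_ne_zero t ht),
      hEx t ht, hEy t ht, hp₂ t ht, hq₂ t ht, hxy ht]
  · have hv := hvw ht
    have hD := (depth_pos ha hb (y₁ t) 0).ne'
    simp only [hxy ht] at hv
    exact mul_right_cancel₀ hD ((div_left_inj' hE0).mp hv)

end IsSolutionOn

theorem IsReducedSolutionOn.isSolutionOn (ha : 0 < a) (hb : 0 < b) {I : Set ℝ} {γ E : ℝ}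
    (hE : 0 < E) {x v x₂ : ℝ → ℝ} (hx : IsReducedSolutionOn a b (γ ^ 2 / E ^ 2) I x v)
    (hsq : ∀ t ∈ I, v t ^ 2 = depth a b (x t) 0 - γ ^ 2 / E ^ 2 * depth a b (x t) 0 ^ 2)
    (hx₂ : ∀ t ∈ I, HasDerivAt x₂ (γ * depth a b (x t) 0 / E) t) :
    IsSolutionOn a b I x x₂ (fun t ↦ E * v t / depth a b (x t) 0) fun _ ↦ γ := by
  have hD (t : ℝ) : depth a b (x t) 0 ≠ 0 := (depth_pos ha hb (x t) 0).ne'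
  have hlevel (t : ℝ) (ht : t ∈ I) :
      ((E * v t / depth a b (x t) 0) ^ 2 + γ ^ 2) * depth a b (x t) 0 = E ^ 2 := by
    have := hD t
    rw [div_pow, mul_pow, hsq t ht]
    field_simp
    ring
  have hp (t : ℝ) (ht : t ∈ I) : ¬ (E * v t / depth a b (x t) 0 = 0 ∧ γ = 0) := by
    rintro ⟨hv, hγ⟩
    have := hlevel t ht
    rw [hv, hγ, zero_pow two_ne_zero, add_zero, zero_mul] at this
    exact (pow_pos hE 2).ne this
  have hH (t : ℝ) (ht : t ∈ I) :
      hamiltonian a b (x t) (x₂ t) (E * v t / depth a b (x t) 0) γ = E := by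
    rw [hamiltonian_eq_sqrt]
    exact (congr_arg Real.sqrt (hlevel t ht)).trans (Real.sqrt_sq hE.le)
  refine ⟨hp, fun t ht ↦ (hx.x_dot t ht).congr_deriv ?_, fun t ht ↦ (hx₂ t ht).congr_deriv ?_,
    fun t ht ↦ ?_, fun t _ ↦ ?_⟩
  · rw [deriv_hamiltonian_p₁ ha hb _ _ (hp t ht), hH t ht, div_mul_cancel₀ _ (hD t),
      mul_div_cancel_left₀ _ hE.ne']
  · rw [deriv_hamiltonian_p₂ ha hb _ _ (hp t ht), hH t ht]
  · refine (((hx.v_dot t ht).const_mul E).fun_div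
      ((hasDerivAt_depth ha b (x t) 0).comp t (hx.x_dot t ht)) (hD t)).congr_deriv ?_
    have hD' := hD t
    have hA : x t ^ 2 + a ≠ 0 := by positivity
    have henergy := hsq t ht
    rw [deriv_hamiltonian_x₁ ha hb _ _ (hp t ht), hH t ht, acceleration]
    simp only [Function.comp]
    field_simp at henergy ⊢
    linear_combination -(a - b) * x t * henergy
  · simpa only [deriv_hamiltonian_x₂, neg_zero] using hasDerivAt_const t γ

end Hamiltonian

/-! ### Time changes of the Weierstrass functions -/

section TimeChange

open scoped PeriodPair

lemma notMem_lattice_of_mem_closure (L : PeriodPair) {p Y : ℝ → ℂ} {S : Set ℝ} {t : ℝ}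
    (hp : ContinuousAt p t) (hY : ContinuousAt Y t) (hS : ∀ s ∈ S, p s ∉ L.lattice)
    (hYS : ∀ s ∈ S, ℘[L] (p s) = Y s) (ht : t ∈ closure S) : p t ∉ L.lattice := by
  intro hmem
  have : (𝓝[S] t).NeBot := mem_closure_iff_nhdsWithin_neBot.mp ht
  have hpt : Tendsto p (𝓝[S] t) (𝓝[≠] (p t)) :=
    tendsto_nhdsWithin_iff.mpr ⟨hp.mono_left nhdsWithin_le_nhds,
      eventually_nhdsWithin_of_forall fun s hs heq ↦ hS s hs (by rwa [heq])⟩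
  have hYt : Tendsto (fun s ↦ ℘[L] (p s)) (𝓝[S] t) (𝓝 (Y t)) :=
    (hY.mono_left nhdsWithin_le_nhds).congr'
      (eventually_nhdsWithin_of_forall fun s hs ↦ (hYS s hs).symm)
  exact not_tendsto_nhds_of_tendsto_atTop
    (tendsto_norm_cobounded_atTop.comp ((tendsto_weierstrassP_cobounded L hmem).comp hpt)) _
    hYt.norm

/-- The autonomous system `(℘, ℘')' = (℘', 6 ℘² - g₂ / 2)` satisfied by `℘` and its derivative. -/
noncomputable def weierstrassField (g₂ : ℂ) (q : ℂ × ℂ) : ℂ × ℂ := (q.2, 6 * q.1 ^ 2 - g₂ / 2)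

lemma hasDerivAt_weierstrassP_comp (L : PeriodPair) {p : ℝ → ℂ} {w : ℂ} {t : ℝ}
    (hp : HasDerivAt p w t) (ht : p t ∉ L.lattice) :
    HasDerivAt (fun t ↦ (℘[L] (p t), ℘'[L] (p t)))
      (w • weierstrassField L.g₂ (℘[L] (p t), ℘'[L] (p t))) t :=
  ((hasDerivAt_weierstrassP L ht).scomp t hp).prodMk
    ((hasDerivAt_derivWeierstrassP L ht).scomp t hp)

theorem weierstrassP_comp_eq_of_hasDerivAt (L : PeriodPair) {p w : ℝ → ℂ} {Y : ℝ → ℂ × ℂ}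
    (hw : Continuous w) (hp : ∀ t, HasDerivAt p (w t) t)
    (hY : ∀ t, HasDerivAt Y (w t • weierstrassField L.g₂ (Y t)) t) {t₀ : ℝ}
    (h₀ : p t₀ ∉ L.lattice) (hY₀ : (℘[L] (p t₀), ℘'[L] (p t₀)) = Y t₀) (t : ℝ) :
    p t ∉ L.lattice ∧ (℘[L] (p t), ℘'[L] (p t)) = Y t := by
  have hpc (t : ℝ) : ContinuousAt p t := (hp t).continuousAt
  have hYc (t : ℝ) : ContinuousAt Y t := (hY t).continuousAt
  have hF : LocallyLipschitz (weierstrassField L.g₂) :=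
    ContDiff.locallyLipschitz (𝕂 := ℂ) (by unfold weierstrassField; fun_prop)
  suffices h : {t | p t ∉ L.lattice ∧ (℘[L] (p t), ℘'[L] (p t)) = Y t} = Set.univ from
    (h ▸ Set.mem_univ t : t ∈ {t | p t ∉ L.lattice ∧ (℘[L] (p t), ℘'[L] (p t)) = Y t})
  refine IsClopen.eq_univ ⟨isClosed_of_closure_subset fun t ht ↦ ?_,
    isOpen_iff_mem_nhds.mpr fun t ht ↦ ?_⟩ ⟨t₀, h₀, hY₀⟩
  · have hnot := notMem_lattice_of_mem_closure L (hpc t) (hYc t).fst (fun s hs ↦ hs.1)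
      (fun s hs ↦ congr_arg Prod.fst hs.2) ht
    exact ⟨hnot, tendsto_nhds_unique_of_frequently_eq
      (hasDerivAt_weierstrassP_comp L (hp t) hnot).continuousAt (hYc t)
      ((mem_closure_iff_frequently.mp ht).mono fun s hs ↦ hs.2)⟩
  · have hev := (hpc t).eventually (eventually_notMem_lattice L ht.1)
    have heq := eventuallyEq_of_hasDerivAt_smul hF hw.continuousAt
      (hev.mono fun s hs ↦ hasDerivAt_weierstrassP_comp L (hp s) hs) (.of_forall hY) ht.2
    filter_upwards [hev, heq] with s hs hs' using ⟨hs, hs'⟩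

end TimeChange

/-! ### The constants of the trajectory -/

section Constants

variable {a b ξ ψ : ℝ}

lemma csqrt_sq (s : ℝ) : csqrt s ^ 2 = s := by
  simp [csqrt, Complex.sqrt]

lemma csqrt_one : csqrt 1 = 1 := by
  simp [csqrt]

lemma csqrt_sq_mul {k : ℝ} (hk : 0 ≤ k) (s : ℝ) : csqrt (k ^ 2 * s) = k * csqrt s := by
  have hnorm : ‖((k ^ 2 * s : ℝ) : ℂ)‖ = k ^ 2 * ‖(s : ℂ)‖ := by
    rw [Complex.norm_real, Complex.norm_real, norm_mul, norm_pow, Real.norm_of_nonneg hk]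
  have hsqrt (y : ℝ) : √(k ^ 2 * y) = k * √y := by
    rw [Real.sqrt_mul (sq_nonneg k), Real.sqrt_sq hk]
  rw [csqrt, csqrt, Complex.sqrt_eq_real_add_ite, Complex.sqrt_eq_real_add_ite, hnorm,
    Complex.ofReal_re, Complex.ofReal_re, Complex.ofReal_im, Complex.ofReal_im, ← mul_add,
    ← mul_sub, mul_div_assoc, mul_div_assoc, hsqrt, hsqrt]
  push_cast
  ring

lemma rootSign_mul_abs_sin (ψ : ℝ) : rootSign ψ * |Real.sin ψ| = Real.sin ψ := by
  unfold rootSign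
  split_ifs with hneg
  · rw [abs_of_neg hneg, neg_one_mul, neg_neg]
  · rw [abs_of_nonneg (not_lt.mp hneg), one_mul]

lemma depth_neg (a b x y : ℝ) : depth a b (-x) y = depth a b x y := by
  simp only [depth, neg_sq]

lemma frakh_ne_zero (hb : 0 < b) (hψ : (ξ ^ 2 + a) * Real.sin ψ ^ 2 ≠ ξ ^ 2 + b) :
    frakh a b ξ ψ ≠ 0 :=
  div_ne_zero (by positivity) (sub_ne_zero.mpr hψ.symm)

lemma one_sub_inv_frakh (hb : 0 < b) (ξ ψ : ℝ) :
    1 - (frakh a b ξ ψ)⁻¹ = Real.sin ψ ^ 2 / depth a b ξ 0 := by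
  have hB : ξ ^ 2 + b ≠ 0 := by positivity
  unfold frakh depth
  field_simp
  ring

lemma one_sub_inv_frakh_mul_lt (hb : 0 < b) (hab : b < a) (hξ : 0 < ξ) (ψ : ℝ) :
    (1 - (frakh a b ξ ψ)⁻¹) * b < a := by
  have ha := hb.trans hab
  rw [one_sub_inv_frakh hb]
  calc Real.sin ψ ^ 2 / depth a b ξ 0 * b
      ≤ 1 / depth a b ξ 0 * b := by
        have := depth_pos ha hb ξ 0
        gcongr
        exact Real.sin_sq_le_one ψ
    _ = (ξ ^ 2 + a) * b / (ξ ^ 2 + b) := by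
        rw [depth, one_div_div, div_mul_eq_mul_div]
    _ < a := by
        rw [div_lt_iff₀ (by positivity)]
        nlinarith [mul_pos (sub_pos.mpr hab) (pow_pos hξ 2)]

lemma h_sq (a b ξ ψ : ℝ) : h a b ξ ψ ^ 2 = frakh a b ξ ψ := csqrt_sq _

lemma h_ne_zero (hb : 0 < b) (hψ : (ξ ^ 2 + a) * Real.sin ψ ^ 2 ≠ ξ ^ 2 + b) :
    h a b ξ ψ ≠ 0 := by
  refine ne_zero_pow two_ne_zero ?_
  rw [h_sq]
  exact_mod_cast frakh_ne_zero hb hψ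

lemma rootSign_mul_sqrt (hb : 0 < b) (ξ ψ : ℝ) :
    rootSign ψ * √(1 - (frakh a b ξ ψ)⁻¹) = Real.sin ψ / √(depth a b ξ 0) := by
  rw [one_sub_inv_frakh hb, Real.sqrt_div (sq_nonneg _), Real.sqrt_sq_eq_abs,
    ← mul_div_assoc, rootSign_mul_abs_sin]

lemma rootSign_mul_csqrt (ha : 0 < a) (hb : 0 < b)
    (hψ : (ξ ^ 2 + a) * Real.sin ψ ^ 2 ≠ ξ ^ 2 + b) :
    (rootSign ψ : ℂ) * csqrt (frakh a b ξ ψ - 1) =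
      ((Real.sin ψ / √(depth a b ξ 0) : ℝ) : ℂ) * h a b ξ ψ := by
  have hsq : frakh a b ξ ψ - 1 = (|Real.sin ψ| / √(depth a b ξ 0)) ^ 2 * frakh a b ξ ψ := by
    rw [div_pow, sq_abs, Real.sq_sqrt (depth_pos ha hb ξ 0).le, ← one_sub_inv_frakh hb, sub_mul,
      inv_mul_cancel₀ (frakh_ne_zero hb hψ), one_mul]
  rw [hsq, csqrt_sq_mul (by positivity), ← mul_assoc, h, ← Complex.ofReal_mul, ← mul_div_assoc,
    rootSign_mul_abs_sin]

lemma momentumCoeff_eq (ha : 0 < a) (hb : 0 < b)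
    (hψ : (ξ ^ 2 + a) * Real.sin ψ ^ 2 ≠ ξ ^ 2 + b) :
    momentumCoeff a b ξ ψ = (√(depth a b ξ 0) : ℂ) / h a b ξ ψ := by
  unfold momentumCoeff
  split_ifs with hsin
  · have hfrakh : frakh a b ξ ψ = 1 := by
      have : ξ ^ 2 + b ≠ 0 := by positivity
      simp [frakh, hsin, this]
    rw [h, hfrakh, csqrt_one, div_one, depth]
  · have hsin' : (Real.sin ψ : ℂ) ≠ 0 := by exact_mod_cast hsin
    rw [rootSign_mul_csqrt ha hb hψ, Complex.ofReal_div, div_mul_eq_mul_div, div_div_eq_mul_div,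
      mul_div_mul_left _ _ hsin']

-- The cubic `4 X³ - α X - β` vanishes where `X + δ - a = x₁²` is `0`, `-b` or `(b - a) 𝔥 - b`.
lemma discriminant_eq (a b ξ ψ : ℝ) : alpha a b ξ ψ ^ 3 - 27 * beta a b ξ ψ ^ 2 =
    16 * (b * ((b - a) * frakh a b ξ ψ) * (b - (b - a) * frakh a b ξ ψ)) ^ 2 := by
  unfold alpha beta
  ring

lemma discriminant_ne_zero (hb : 0 < b) (hab : b < a) (hξ : 0 < ξ)
    (hψ : (ξ ^ 2 + a) * Real.sin ψ ^ 2 ≠ ξ ^ 2 + b) :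
    alpha a b ξ ψ ^ 3 ≠ 27 * beta a b ξ ψ ^ 2 := by
  have hfrakh := frakh_ne_zero hb hψ
  have hthird : b - (b - a) * frakh a b ξ ψ ≠ 0 := fun hzero ↦
    (one_sub_inv_frakh_mul_lt hb hab hξ ψ).ne (by field_simp; linear_combination -hzero)
  rw [← sub_ne_zero, discriminant_eq]
  exact mul_ne_zero (by norm_num) <| pow_ne_zero 2 <|
    mul_ne_zero (mul_ne_zero hb.ne' (mul_ne_zero (sub_ne_zero.mpr hab.ne) hfrakh)) hthird

theorem exists_hasInvariants (hb : 0 < b) (hab : b < a) (hξ : 0 < ξ)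
    (hψ : (ξ ^ 2 + a) * Real.sin ψ ^ 2 ≠ ξ ^ 2 + b) :
    ∃ L : PeriodPair, HasInvariants L (alpha a b ξ ψ) (beta a b ξ ψ) :=
  exists_periodPair_of_discriminant_ne_zero (by exact_mod_cast discriminant_ne_zero hb hab hξ hψ)

theorem exists_isInitialPhase (a b ξ ψ : ℝ) (L : PeriodPair) :
    ∃ p₀ : ℂ, IsInitialPhase a b ξ ψ L p₀ := by
  obtain ⟨z, hz, hzP⟩ := exists_weierstrassP_eq L ((ξ ^ 2 - delta a b ξ ψ + a : ℝ) : ℂ)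
  rcases le_total ((L.derivWeierstrassP z / h a b ξ ψ).re * Real.cos ψ) 0 with hle | hge
  · exact ⟨z, hz, hzP, hle⟩
  · refine ⟨-z, mt L.lattice.neg_mem_iff.mp hz, by rwa [L.weierstrassP_neg], ?_⟩
    rw [L.derivWeierstrassP_neg, neg_div, Complex.neg_re]
    linarith

end Constants

/-! ### The trajectory and its phase -/

section Trajectory

variable {a b ξ ψ : ℝ} {L : PeriodPair} {p₀ : ℂ} {p q : ℝ → ℂ} {x v s : ℝ → ℝ}

lemma hasStrictDerivAt_const_mul_sub_weierstrassZeta (L : PeriodPair) (c : ℂ) {z : ℂ}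
    (hz : z ∉ L.lattice) :
    HasStrictDerivAt (fun z ↦ c * z - weierstrassZeta L z) (c + L.weierstrassP z) z := by
  have hdiff : DifferentiableOn ℂ (weierstrassZeta L) (L.lattice : Set ℂ)ᶜ := fun z hz ↦
    (hasDerivAt_weierstrassZeta L hz).differentiableAt.differentiableWithinAt
  have hstrict := (hdiff.analyticAt ((isOpen_compl_lattice L).mem_nhds hz)).hasStrictDerivAt
  rw [(hasDerivAt_weierstrassZeta L hz).deriv] at hstrict
  refine (((hasStrictDerivAt_id z).const_mul c).sub hstrict).congr_deriv ?_
  rw [mul_one, sub_neg_eq_add]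

lemma IsPhase.eq_of_weierstrassP_add_delta_ne_zero (hp : IsPhase a b ξ ψ L p₀ p)
    (hq : IsPhase a b ξ ψ L p₀ q) (hne : ∀ t, L.weierstrassP (p t) + delta a b ξ ψ ≠ 0) :
    q = p := by
  refine (eq_of_comp_eq_of_hasStrictDerivAt hp.continuous hq.continuous (fun t ↦ ?_) (fun t ↦
    ⟨_, ?_, hasStrictDerivAt_const_mul_sub_weierstrassZeta L (delta a b ξ ψ) (hp.notMem t)⟩)
    (hp.initial.trans hq.initial.symm)).symm
  · linear_combination hq.equation t - hp.equation t
  · rw [add_comm]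
    exact hne t

/-- The first coordinate `x` of the solution of the Cauchy problem, with its velocity `v`: as
`κ = p₂² / H² = 1 - 𝔥⁻¹` on this solution, it solves `ẍ = ½ (D - κ D²)'(x)`. -/
structure IsTrajectory (a b ξ ψ : ℝ) (x v : ℝ → ℝ) : Prop where
  isReducedSolutionOn : IsReducedSolutionOn a b (1 - (frakh a b ξ ψ)⁻¹) Set.univ x v
  position_zero : x 0 = -ξ
  velocity_zero : v 0 = √(depth a b ξ 0) * Real.cos ψ

lemma exists_isTrajectory (ha : 0 < a) (b ξ ψ : ℝ) : ∃ x v, IsTrajectory a b ξ ψ x v := by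
  obtain ⟨x, v, hx₀, hv₀, hx⟩ := exists_isReducedSolutionOn_univ ha b (1 - (frakh a b ξ ψ)⁻¹)
    (-ξ) (√(depth a b ξ 0) * Real.cos ψ)
  exact ⟨x, v, hx, hx₀, hv₀⟩

lemma sqrt_depth_mul_cos_sq (ha : 0 < a) (hb : 0 < b) (ξ ψ : ℝ) :
    (√(depth a b ξ 0) * Real.cos ψ) ^ 2 =
      depth a b ξ 0 - (1 - (frakh a b ξ ψ)⁻¹) * depth a b ξ 0 ^ 2 := by
  have hD := depth_pos ha hb ξ 0
  rw [one_sub_inv_frakh hb, mul_pow, Real.sq_sqrt hD.le, Real.cos_sq']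
  field_simp

lemma weierstrass_cubic_eq (ha : 0 < a) (hf : frakh a b ξ ψ ≠ 0) {y u : ℝ}
    (hu : u ^ 2 = depth a b y 0 - (1 - (frakh a b ξ ψ)⁻¹) * depth a b y 0 ^ 2) :
    4 * (y ^ 2 - delta a b ξ ψ + a) ^ 3 - alpha a b ξ ψ * (y ^ 2 - delta a b ξ ψ + a) -
      beta a b ξ ψ = frakh a b ξ ψ * (2 * y * u * (y ^ 2 + a)) ^ 2 := by
  have hA : y ^ 2 + a ≠ 0 := by positivity
  rw [mul_pow, mul_pow, hu]
  unfold alpha beta delta depth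
  generalize frakh a b ξ ψ = f at hf ⊢
  field_simp
  ring

lemma IsInitialPhase.derivWeierstrassP_eq (ha : 0 < a) (hb : 0 < b) (hξ : 0 < ξ)
    (hψ : (ξ ^ 2 + a) * Real.sin ψ ^ 2 ≠ ξ ^ 2 + b)
    (hL : HasInvariants L (alpha a b ξ ψ) (beta a b ξ ψ)) (hp₀ : IsInitialPhase a b ξ ψ L p₀) :
    L.derivWeierstrassP p₀ =
      -(h a b ξ ψ * ((2 * ξ * (√(depth a b ξ 0) * Real.cos ψ) * (ξ ^ 2 + a) : ℝ) : ℂ)) := by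
  obtain ⟨hmem, hP, hsign⟩ := hp₀
  have hh := h_ne_zero hb hψ
  have hE : 0 < √(depth a b ξ 0) := Real.sqrt_pos.mpr (depth_pos ha hb ξ 0)
  have hcubic := weierstrass_cubic_eq ha (frakh_ne_zero hb hψ) (sqrt_depth_mul_cos_sq ha hb ξ ψ)
  set R : ℝ := 2 * ξ * (√(depth a b ξ 0) * Real.cos ψ) * (ξ ^ 2 + a) with hR
  have hsq : L.derivWeierstrassP p₀ ^ 2 = (h a b ξ ψ * (R : ℂ)) ^ 2 := by
    rw [L.derivWeierstrassP_sq p₀ hmem, hP, hL.1, hL.2, mul_pow, h_sq]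
    exact_mod_cast hcubic
  rcases sq_eq_sq_iff_eq_or_eq_neg.mp hsq with heq | heq
  · rw [heq, mul_div_cancel_left₀ _ hh, Complex.ofReal_re] at hsign
    have hcos : Real.cos ψ = 0 := by
      by_contra! hne
      have hpos : 0 < 2 * ξ * √(depth a b ξ 0) * (ξ ^ 2 + a) * Real.cos ψ ^ 2 := by positivity
      linarith
    have hR0 : R = 0 := by rw [hR, hcos, mul_zero, mul_zero, zero_mul]
    rw [heq, hR0, Complex.ofReal_zero, mul_zero, neg_zero]
  · exact heq

/-- The time change `∫₀ᵗ ds / (x(s)² + a)` along a trajectory. -/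
noncomputable def timeChange (a : ℝ) (x : ℝ → ℝ) (t : ℝ) : ℝ :=
  ∫ s in (0 : ℝ)..t, (x s ^ 2 + a)⁻¹

lemma timeChange_zero (a : ℝ) (x : ℝ → ℝ) : timeChange a x 0 = 0 :=
  intervalIntegral.integral_same

lemma continuous_inv_sq_add (ha : 0 < a) (hx : Continuous x) :
    Continuous fun t ↦ (x t ^ 2 + a)⁻¹ :=
  ((hx.pow 2).add continuous_const).inv₀ fun t ↦ (by positivity : x t ^ 2 + a ≠ 0)

lemma hasDerivAt_timeChange (ha : 0 < a) (hx : Continuous x) (t : ℝ) :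
    HasDerivAt (timeChange a x) (x t ^ 2 + a)⁻¹ t :=
  ((continuous_inv_sq_add ha hx).integral_hasStrictDerivAt 0 t).hasDerivAt

/-- The phase `𝔭(t) = 𝔭₀ + h⁻¹ ∫₀ᵗ ds / (x(s)² + a)` of the trajectory with first coordinate `x`. -/
noncomputable def phase (a b ξ ψ : ℝ) (p₀ : ℂ) (x : ℝ → ℝ) (t : ℝ) : ℂ :=
  p₀ + (h a b ξ ψ)⁻¹ * (timeChange a x t : ℂ)

lemma phase_zero (a b ξ ψ : ℝ) (p₀ : ℂ) (x : ℝ → ℝ) : phase a b ξ ψ p₀ x 0 = p₀ := by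
  rw [phase, timeChange_zero, Complex.ofReal_zero, mul_zero, add_zero]

lemma hasDerivAt_phase (ha : 0 < a) (b ξ ψ : ℝ) (p₀ : ℂ) (hx : Continuous x) (t : ℝ) :
    HasDerivAt (phase a b ξ ψ p₀ x) ((h a b ξ ψ)⁻¹ * (((x t ^ 2 + a)⁻¹ : ℝ) : ℂ)) t :=
  ((hasDerivAt_timeChange ha hx t).ofReal_comp.const_mul _).const_add p₀

/-- The second coordinate `∫₀ᵗ sin ψ D(x(s)) / H ds` of the trajectory with first coordinate `x`,
in terms of the time change: `D(x) = 1 + (b - a) / (x² + a)`, and `H² = D(-ξ)`. -/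
noncomputable def secondCoordinate (a b ξ ψ : ℝ) (x : ℝ → ℝ) (t : ℝ) : ℝ :=
  Real.sin ψ / √(depth a b ξ 0) * (t + (b - a) * timeChange a x t)

lemma hasDerivAt_secondCoordinate (ha : 0 < a) (b ξ ψ : ℝ) (hx : Continuous x) (t : ℝ) :
    HasDerivAt (secondCoordinate a b ξ ψ x)
      (Real.sin ψ * depth a b (x t) 0 / √(depth a b ξ 0)) t := by
  refine (((hasDerivAt_id' t).fun_add
    ((hasDerivAt_timeChange ha hx t).const_mul (b - a))).const_mul _).congr_deriv ?_
  rw [depth_eq_one_add ha b (x t), div_mul_eq_mul_div]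

/-- The first momentum `H ẋ / D(x)` of the trajectory with first coordinate `x` and velocity `v`. -/
noncomputable def firstMomentum (a b ξ : ℝ) (x v : ℝ → ℝ) (t : ℝ) : ℝ :=
  √(depth a b ξ 0) * v t / depth a b (x t) 0

namespace IsTrajectory

lemma hasDerivAt (hx : IsTrajectory a b ξ ψ x v) (t : ℝ) : HasDerivAt x (v t) t :=
  hx.isReducedSolutionOn.x_dot t trivial

lemma continuous (hx : IsTrajectory a b ξ ψ x v) : Continuous x :=
  continuous_iff_continuousAt.mpr fun t ↦ (hx.hasDerivAt t).continuousAt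

lemma velocity_sq (ha : 0 < a) (hb : 0 < b) (hx : IsTrajectory a b ξ ψ x v) (t : ℝ) :
    v t ^ 2 = depth a b (x t) 0 - (1 - (frakh a b ξ ψ)⁻¹) * depth a b (x t) 0 ^ 2 :=
  hx.isReducedSolutionOn.sq_eq ha (t₀ := 0)
    (by rw [hx.velocity_zero, hx.position_zero, depth_neg, sqrt_depth_mul_cos_sq ha hb]) t

lemma velocity_ne_zero (hb : 0 < b) (hab : b < a) (hξ : 0 < ξ) (hx : IsTrajectory a b ξ ψ x v)
    {t : ℝ} (ht : x t = 0) : v t ≠ 0 := by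
  have ha := hb.trans hab
  have hlt := one_sub_inv_frakh_mul_lt hb hab hξ ψ
  have hD : depth a b 0 0 = b / a := by simp only [depth, zero_pow two_ne_zero, zero_add]
  have hsq : v t ^ 2 = b / a ^ 2 * (a - (1 - (frakh a b ξ ψ)⁻¹) * b) := by
    rw [hx.velocity_sq ha hb t, ht, hD]
    field_simp
  refine ne_zero_pow two_ne_zero ?_
  rw [hsq]
  exact (mul_pos (by positivity) (sub_pos.mpr hlt)).ne'

lemma hasDerivAt_sq_sub_delta_add (ha : 0 < a) (hx : IsTrajectory a b ξ ψ x v) (t : ℝ) :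
    HasDerivAt (fun t ↦ x t ^ 2 - delta a b ξ ψ + a)
      ((x t ^ 2 + a)⁻¹ * (2 * x t * v t * (x t ^ 2 + a))) t := by
  have hA : x t ^ 2 + a ≠ 0 := by positivity
  refine ((((hx.hasDerivAt t).fun_pow 2).sub_const _).add_const a).congr_deriv ?_
  field_simp
  push_cast
  ring

lemma hasDerivAt_mul_velocity_mul_sq_add (ha : 0 < a) (hb : 0 < b)
    (hψ : (ξ ^ 2 + a) * Real.sin ψ ^ 2 ≠ ξ ^ 2 + b) (hx : IsTrajectory a b ξ ψ x v) (t : ℝ) :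
    HasDerivAt (fun t ↦ 2 * x t * v t * (x t ^ 2 + a))
      ((frakh a b ξ ψ)⁻¹ * ((x t ^ 2 + a)⁻¹ *
        (6 * (x t ^ 2 - delta a b ξ ψ + a) ^ 2 - alpha a b ξ ψ / 2))) t := by
  have hA : x t ^ 2 + a ≠ 0 := by positivity
  have hf := frakh_ne_zero hb hψ
  have hd := (((hx.hasDerivAt t).const_mul 2).fun_mul
    (hx.isReducedSolutionOn.v_dot t trivial)).fun_mul (((hx.hasDerivAt t).fun_pow 2).add_const a)
  refine hd.congr_deriv ?_
  calc _ = 2 * (x t ^ 2 + a) * (v t ^ 2 + x t * acceleration a b (1 - (frakh a b ξ ψ)⁻¹) (x t)) +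
          4 * x t ^ 2 * v t ^ 2 := by push_cast; ring
    _ = _ := by
      rw [hx.velocity_sq ha hb t, acceleration]
      unfold depth delta alpha
      generalize frakh a b ξ ψ = f at hf ⊢
      field_simp
      ring

theorem weierstrassP_phase (ha : 0 < a) (hb : 0 < b) (hξ : 0 < ξ)
    (hψ : (ξ ^ 2 + a) * Real.sin ψ ^ 2 ≠ ξ ^ 2 + b)
    (hL : HasInvariants L (alpha a b ξ ψ) (beta a b ξ ψ)) (hp₀ : IsInitialPhase a b ξ ψ L p₀)
    (hx : IsTrajectory a b ξ ψ x v) (t : ℝ) :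
    phase a b ξ ψ p₀ x t ∉ L.lattice ∧
      L.weierstrassP (phase a b ξ ψ p₀ x t) = ((x t ^ 2 - delta a b ξ ψ + a : ℝ) : ℂ) ∧
      L.derivWeierstrassP (phase a b ξ ψ p₀ x t) =
        h a b ξ ψ * ((2 * x t * v t * (x t ^ 2 + a) : ℝ) : ℂ) := by
  have hh := h_ne_zero hb hψ
  have hderiv (t : ℝ) := (hx.hasDerivAt_sq_sub_delta_add ha t).ofReal_comp.prodMk
    ((hx.hasDerivAt_mul_velocity_mul_sq_add ha hb hψ t).ofReal_comp.const_mul (h a b ξ ψ))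
  have hmem₀ : phase a b ξ ψ p₀ x 0 ∉ L.lattice := by
    rw [phase_zero]
    exact hp₀.1
  have hinitial : (L.weierstrassP (phase a b ξ ψ p₀ x 0),
      L.derivWeierstrassP (phase a b ξ ψ p₀ x 0)) =
      (((x 0 ^ 2 - delta a b ξ ψ + a : ℝ) : ℂ),
        h a b ξ ψ * ((2 * x 0 * v 0 * (x 0 ^ 2 + a) : ℝ) : ℂ)) := by
    rw [phase_zero, hp₀.2.1, hp₀.derivWeierstrassP_eq ha hb hξ hψ hL, hx.position_zero,
      hx.velocity_zero, neg_sq, mul_neg, neg_mul, neg_mul, Complex.ofReal_neg, mul_neg]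
  have hspeed : Continuous fun t ↦ (h a b ξ ψ)⁻¹ * (((x t ^ 2 + a)⁻¹ : ℝ) : ℂ) :=
    continuous_const.mul (Complex.continuous_ofReal.comp (continuous_inv_sq_add ha hx.continuous))
  have hphase := weierstrassP_comp_eq_of_hasDerivAt L hspeed
    (hasDerivAt_phase ha b ξ ψ p₀ hx.continuous)
    (fun t ↦ (hderiv t).congr_deriv (Prod.ext ?_ ?_)) hmem₀ hinitial t
  · exact ⟨hphase.1, Prod.ext_iff.mp hphase.2⟩
  · simp only [weierstrassField, Prod.smul_fst, smul_eq_mul, Complex.ofReal_mul]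
    field_simp
  · simp only [weierstrassField, Prod.smul_snd, smul_eq_mul, hL.1]
    push_cast
    rw [← h_sq]
    field_simp

lemma weierstrassP_phase_add_delta_sub (ha : 0 < a) (hb : 0 < b) (hξ : 0 < ξ)
    (hψ : (ξ ^ 2 + a) * Real.sin ψ ^ 2 ≠ ξ ^ 2 + b)
    (hL : HasInvariants L (alpha a b ξ ψ) (beta a b ξ ψ)) (hp₀ : IsInitialPhase a b ξ ψ L p₀)
    (hx : IsTrajectory a b ξ ψ x v) (t : ℝ) :
    L.weierstrassP (phase a b ξ ψ p₀ x t) + (delta a b ξ ψ : ℂ) - (a : ℂ) = (x t : ℂ) ^ 2 := by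
  rw [(hx.weierstrassP_phase ha hb hξ hψ hL hp₀ t).2.1]
  push_cast
  ring

theorem isPhase (ha : 0 < a) (hb : 0 < b) (hξ : 0 < ξ)
    (hψ : (ξ ^ 2 + a) * Real.sin ψ ^ 2 ≠ ξ ^ 2 + b)
    (hL : HasInvariants L (alpha a b ξ ψ) (beta a b ξ ψ)) (hp₀ : IsInitialPhase a b ξ ψ L p₀)
    (hx : IsTrajectory a b ξ ψ x v) : IsPhase a b ξ ψ L p₀ (phase a b ξ ψ p₀ x) := by
  have hmem (t : ℝ) := (hx.weierstrassP_phase ha hb hξ hψ hL hp₀ t).1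
  have hd := hasDerivAt_phase ha b ξ ψ p₀ hx.continuous
  have hzero (t : ℝ) : HasDerivAt (fun t : ℝ ↦ delta a b ξ ψ * phase a b ξ ψ p₀ x t -
      weierstrassZeta L (phase a b ξ ψ p₀ x t) - t / h a b ξ ψ) 0 t := by
    have hA : (x t : ℂ) ^ 2 + a ≠ 0 := by
      exact_mod_cast (by positivity : (0 : ℝ) < x t ^ 2 + a).ne'
    refine (((hasStrictDerivAt_const_mul_sub_weierstrassZeta L (delta a b ξ ψ)
      (hmem t)).hasDerivAt.scomp t (hd t)).fun_sub
      (Complex.ofRealCLM.hasDerivAt.div_const (h a b ξ ψ))).congr_deriv ?_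
    rw [show (delta a b ξ ψ : ℂ) + L.weierstrassP (phase a b ξ ψ p₀ x t) = x t ^ 2 + a by
      linear_combination hx.weierstrassP_phase_add_delta_sub ha hb hξ hψ hL hp₀ t, smul_eq_mul]
    push_cast
    rw [Complex.ofRealCLM_apply, Complex.ofReal_one, mul_assoc, inv_mul_cancel₀ hA, mul_one,
      one_div, sub_self]
  refine ⟨continuous_iff_continuousAt.mpr fun t ↦ (hd t).continuousAt,
    phase_zero a b ξ ψ p₀ x, hmem, fun t ↦ ?_⟩
  have hconst := is_const_of_deriv_eq_zero (fun t ↦ (hzero t).differentiableAt)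
    (fun t ↦ (hzero t).deriv) t 0
  rw [phase_zero, Complex.ofReal_zero, zero_div, sub_zero] at hconst
  linear_combination -hconst

theorem eq_phase (ha : 0 < a) (hb : 0 < b) (hξ : 0 < ξ)
    (hψ : (ξ ^ 2 + a) * Real.sin ψ ^ 2 ≠ ξ ^ 2 + b)
    (hL : HasInvariants L (alpha a b ξ ψ) (beta a b ξ ψ)) (hp₀ : IsInitialPhase a b ξ ψ L p₀)
    (hx : IsTrajectory a b ξ ψ x v) (hq : IsPhase a b ξ ψ L p₀ q) :
    q = phase a b ξ ψ p₀ x := by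
  refine (hx.isPhase ha hb hξ hψ hL hp₀).eq_of_weierstrassP_add_delta_ne_zero hq fun t ↦ ?_
  rw [sub_eq_iff_eq_add.mp (hx.weierstrassP_phase_add_delta_sub ha hb hξ hψ hL hp₀ t)]
  exact_mod_cast (by positivity : (0 : ℝ) < x t ^ 2 + a).ne'

theorem isRootBranch (ha : 0 < a) (hb : 0 < b) (hξ : 0 < ξ)
    (hψ : (ξ ^ 2 + a) * Real.sin ψ ^ 2 ≠ ξ ^ 2 + b)
    (hL : HasInvariants L (alpha a b ξ ψ) (beta a b ξ ψ)) (hp₀ : IsInitialPhase a b ξ ψ L p₀)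
    (hx : IsTrajectory a b ξ ψ x v) :
    IsRootBranch a b ξ ψ L (phase a b ξ ψ p₀ x) fun t ↦ -x t where
  differentiable t := (hx.hasDerivAt t).differentiableAt.neg
  initial := by rw [hx.position_zero, neg_neg]
  sq t := by
    rw [hx.weierstrassP_phase_add_delta_sub ha hb hξ hψ hL hp₀, Complex.ofReal_neg, neg_sq]

theorem eq_neg_of_isRootBranch (hb : 0 < b) (hab : b < a) (hξ : 0 < ξ)
    (hψ : (ξ ^ 2 + a) * Real.sin ψ ^ 2 ≠ ξ ^ 2 + b)
    (hL : HasInvariants L (alpha a b ξ ψ) (beta a b ξ ψ)) (hp₀ : IsInitialPhase a b ξ ψ L p₀)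
    (hx : IsTrajectory a b ξ ψ x v) (hs : IsRootBranch a b ξ ψ L (phase a b ξ ψ p₀ x) s) :
    s = fun t ↦ -x t := by
  have hr := hx.isRootBranch (hb.trans hab) hb hξ hψ hL hp₀
  refine eq_of_sq_eq_sq_of_deriv_ne_zero hr.differentiable hs.differentiable (fun t ↦ ?_)
    (fun t ht ↦ ?_) (hs.initial.trans hr.initial.symm) (hr.initial.trans_ne hξ.ne')
  · exact_mod_cast (hs.sq t).trans (hr.sq t).symm
  · rw [(hx.hasDerivAt t).fun_neg.deriv]
    exact neg_ne_zero.mpr (hx.velocity_ne_zero hb hab hξ (neg_eq_zero.mp ht))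

theorem isSolutionOn (ha : 0 < a) (hb : 0 < b) (hx : IsTrajectory a b ξ ψ x v) :
    IsSolutionOn a b Set.univ x (secondCoordinate a b ξ ψ x) (firstMomentum a b ξ x v)
      fun _ ↦ Real.sin ψ := by
  have hD := depth_pos ha hb ξ 0
  have hκ : 1 - (frakh a b ξ ψ)⁻¹ = Real.sin ψ ^ 2 / √(depth a b ξ 0) ^ 2 := by
    rw [one_sub_inv_frakh hb, Real.sq_sqrt hD.le]
  exact (hκ ▸ hx.isReducedSolutionOn).isSolutionOn ha hb (Real.sqrt_pos.mpr hD)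
    (fun t _ ↦ hκ ▸ hx.velocity_sq ha hb t)
    fun t _ ↦ hasDerivAt_secondCoordinate ha b ξ ψ hx.continuous t

lemma hasInitialData (ha : 0 < a) (hb : 0 < b) (hx : IsTrajectory a b ξ ψ x v) :
    HasInitialData ξ ψ x (secondCoordinate a b ξ ψ x) (firstMomentum a b ξ x v)
      fun _ ↦ Real.sin ψ := by
  have hD := depth_pos ha hb ξ 0
  refine ⟨hx.position_zero, ?_, ?_, rfl⟩
  · rw [secondCoordinate, timeChange_zero, mul_zero, add_zero, mul_zero]
  · rw [firstMomentum, hx.position_zero, hx.velocity_zero, depth_neg, ← mul_assoc,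
      Real.mul_self_sqrt hD.le, mul_div_cancel_left₀ _ hD.ne']

theorem firstMomentum_eq (ha : 0 < a) (hb : 0 < b) (hξ : 0 < ξ)
    (hψ : (ξ ^ 2 + a) * Real.sin ψ ^ 2 ≠ ξ ^ 2 + b)
    (hL : HasInvariants L (alpha a b ξ ψ) (beta a b ξ ψ)) (hp₀ : IsInitialPhase a b ξ ψ L p₀)
    (hx : IsTrajectory a b ξ ψ x v) {t : ℝ} (ht : -x t ≠ 0) :
    (firstMomentum a b ξ x v t : ℂ) = -(1 / 2) * momentumCoeff a b ξ ψ *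
      (L.derivWeierstrassP (phase a b ξ ψ p₀ x t) /
        (L.weierstrassP (phase a b ξ ψ p₀ x t) + (delta a b ξ ψ : ℂ) - (a : ℂ) + (b : ℂ))) *
      (1 / ((-x t : ℝ) : ℂ)) := by
  have hh := h_ne_zero hb hψ
  have hxt : (x t : ℂ) ≠ 0 := by exact_mod_cast neg_ne_zero.mp ht
  have hA : (x t : ℂ) ^ 2 + a ≠ 0 := by exact_mod_cast (by positivity : (0 : ℝ) < x t ^ 2 + a).ne'
  have hB : (x t : ℂ) ^ 2 + b ≠ 0 := by exact_mod_cast (by positivity : (0 : ℝ) < x t ^ 2 + b).ne'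
  rw [momentumCoeff_eq ha hb hψ, (hx.weierstrassP_phase ha hb hξ hψ hL hp₀ t).2.2,
    hx.weierstrassP_phase_add_delta_sub ha hb hξ hψ hL hp₀, firstMomentum, depth.eq_def a b (x t)]
  push_cast
  field_simp

end IsTrajectory

lemma secondCoordinate_eq (ha : 0 < a) (hb : 0 < b)
    (hψ : (ξ ^ 2 + a) * Real.sin ψ ^ 2 ≠ ξ ^ 2 + b) (p₀ : ℂ) (x : ℝ → ℝ) (t : ℝ) :
    (secondCoordinate a b ξ ψ x t : ℂ) =
      (rootSign ψ : ℂ) * ((√(1 - (frakh a b ξ ψ)⁻¹) : ℝ) : ℂ) * (t : ℂ) +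
        (rootSign ψ : ℂ) * csqrt (frakh a b ξ ψ - 1) * ((b : ℂ) - (a : ℂ)) *
          (phase a b ξ ψ p₀ x t - p₀) := by
  have hh := h_ne_zero hb hψ
  rw [← Complex.ofReal_mul, rootSign_mul_sqrt hb, rootSign_mul_csqrt ha hb hψ, phase,
    secondCoordinate]
  push_cast
  field_simp
  ring

theorem IsSolutionOn.eq_of_hasInitialData (ha : 0 < a) (hb : 0 < b) {I : Set ℝ} (hI : IsOpen I)
    (hI' : IsPreconnected I) (h0 : 0 ∈ I) {x₁ x₂ p₁ p₂ y₁ y₂ q₁ q₂ : ℝ → ℝ}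
    (hx : IsSolutionOn a b Set.univ x₁ x₂ p₁ p₂) (hx₀ : HasInitialData ξ ψ x₁ x₂ p₁ p₂)
    (hy : IsSolutionOn a b I y₁ y₂ q₁ q₂) (hy₀ : HasInitialData ξ ψ y₁ y₂ q₁ q₂) {t : ℝ}
    (ht : t ∈ I) : y₁ t = x₁ t ∧ y₂ t = x₂ t ∧ q₁ t = p₁ t ∧ q₂ t = p₂ t := by
  obtain ⟨h₁, h₂, h₃, h₄⟩ := hy.eqOn ha hb hI hI' (hx.mono I.subset_univ) h0
    (hy₀.1.trans hx₀.1.symm) (hy₀.2.1.trans hx₀.2.1.symm) (hy₀.2.2.1.trans hx₀.2.2.1.symm)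
    (hy₀.2.2.2.trans hx₀.2.2.2.symm)
  exact ⟨h₁ ht, h₂ ht, h₃ ht, h₄ ht⟩

end Trajectory

end Ridge

theorem theorem2 (a b ξ ψ : ℝ) (hb : 0 < b) (hab : b < a) (hξ : 0 < ξ)
    (hψ : (ξ ^ 2 + a) * Real.sin ψ ^ 2 ≠ ξ ^ 2 + b) :
    (∃ L : PeriodPair, Ridge.HasInvariants L (Ridge.alpha a b ξ ψ) (Ridge.beta a b ξ ψ)) ∧
    ∀ L : PeriodPair, Ridge.HasInvariants L (Ridge.alpha a b ξ ψ) (Ridge.beta a b ξ ψ) →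
      (∃ p₀ : ℂ, Ridge.IsInitialPhase a b ξ ψ L p₀) ∧
      ∀ p₀ : ℂ, Ridge.IsInitialPhase a b ξ ψ L p₀ →
        ∃ (p : ℝ → ℂ) (r x₁ x₂ p₁ p₂ : ℝ → ℝ),
          -- the phase and the branch of the square root exist and are unique
          (Ridge.IsPhase a b ξ ψ L p₀ p ∧ ∀ q, Ridge.IsPhase a b ξ ψ L p₀ q → q = p) ∧
          (Ridge.IsRootBranch a b ξ ψ L p r ∧ ∀ s, Ridge.IsRootBranch a b ξ ψ L p s → s = r) ∧
          -- the solution of the Cauchy problem exists for all times and is unique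
          Ridge.IsSolutionOn a b Set.univ x₁ x₂ p₁ p₂ ∧
          Ridge.HasInitialData ξ ψ x₁ x₂ p₁ p₂ ∧
          (∀ (I : Set ℝ) (y₁ y₂ q₁ q₂ : ℝ → ℝ), IsOpen I → IsPreconnected I → 0 ∈ I →
            Ridge.IsSolutionOn a b I y₁ y₂ q₁ q₂ → Ridge.HasInitialData ξ ψ y₁ y₂ q₁ q₂ →
            ∀ t ∈ I, y₁ t = x₁ t ∧ y₂ t = x₂ t ∧ q₁ t = p₁ t ∧ q₂ t = p₂ t) ∧
          -- the explicit form of the solution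
          (∀ t, x₁ t = -r t) ∧
          (∀ t, (x₂ t : ℂ) =
            (Ridge.rootSign ψ : ℂ) * ((√(1 - (Ridge.frakh a b ξ ψ)⁻¹) : ℝ) : ℂ) * (t : ℂ) +
            (Ridge.rootSign ψ : ℂ) * Ridge.csqrt (Ridge.frakh a b ξ ψ - 1) *
              ((b : ℂ) - (a : ℂ)) * (p t - p₀)) ∧
          (∀ t, r t ≠ 0 → (p₁ t : ℂ) =
            -(1 / 2) * Ridge.momentumCoeff a b ξ ψ *
              (L.derivWeierstrassP (p t) /
                (L.weierstrassP (p t) + (Ridge.delta a b ξ ψ : ℂ) - (a : ℂ) + (b : ℂ))) *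
              (1 / (r t : ℂ))) ∧
          (∀ t, p₂ t = Real.sin ψ) := by
  have ha := hb.trans hab
  refine ⟨Ridge.exists_hasInvariants hb hab hξ hψ, fun L hL ↦
    ⟨Ridge.exists_isInitialPhase a b ξ ψ L, fun p₀ hp₀ ↦ ?_⟩⟩
  obtain ⟨x, v, hx⟩ := Ridge.exists_isTrajectory ha b ξ ψ
  have hsol := hx.isSolutionOn ha hb
  have hinit := hx.hasInitialData ha hb
  exact ⟨Ridge.phase a b ξ ψ p₀ x, fun t ↦ -x t, x, Ridge.secondCoordinate a b ξ ψ x,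
    Ridge.firstMomentum a b ξ x v, fun _ ↦ Real.sin ψ,
    ⟨hx.isPhase ha hb hξ hψ hL hp₀, fun q ↦ hx.eq_phase ha hb hξ hψ hL hp₀⟩,
    ⟨hx.isRootBranch ha hb hξ hψ hL hp₀, fun s ↦ hx.eq_neg_of_isRootBranch hb hab hξ hψ hL hp₀⟩,
    hsol, hinit,
    fun I y₁ y₂ q₁ q₂ hI hI' h0 hy hy₀ t ↦ hsol.eq_of_hasInitialData ha hb hI hI' h0 hinit hy hy₀,
    fun t ↦ (neg_neg (x t)).symm, Ridge.secondCoordinate_eq ha hb hψ p₀ x,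
    fun t ↦ hx.firstMomentum_eq ha hb hξ hψ hL hp₀, fun _ ↦ rfl⟩
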